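/- Let $K$ be a number field of degree $k$ and let $B=\{\omega_1,\dots,\omega_k\}$ be a basis of $K$ over $\mathbb{Q}$. **Notation.** For $q\in K$ let $A_{K,B}(q)\in M_{k\times k}(\mathbb{Q})$ be the matrix, with respect to $B$, of multiplication by $q$ on $K$. Let $A^*_{K,B}:\mathbb{R}^k\to M_{k\times k}(\mathbb{R})$ be the continuous ($\mathbb{R}$-linear) extension of $\mathbf q\mapsto A_{K,B}(q_1\omega_1+\cdots+q_k\omega_k)$, $\mathbf q\in\mathbb{Q}^k$, and let $(\mathbb{R}\otimes_{\mathbb{Q}}K)_B$ be its image, a commutative subalgebra of $M_{k\times k}(\mathbb{R})$. For an embedding $\sigma:K\to\mathbb{C}$ let $\sigma^*:(\mathbb{R}\otimes_{\mathbb{Q}}K)_B\to\mathbb{C}$ be the ring homomorphism that extends $A_{K,B}(q)\mapsto\sigma(q)$ by continuity, and put $\sigma^{**}=\sigma^*\circ A^*_{K,B}:\mathbb{R}^k\to\mathbb{C}$, so that $\sigma^{**}(x_1,\dots,x_k)=\sum_j x_j\sigma(\omega_j)$. Let $\operatorname{tr}^*:(\mathbb{R}\otimes_{\mathbb{Q}}K)_B\to\mathbb{R}$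 be the matrix trace, which extends the field trace $\operatorname{tr}_{K/\mathbb{Q}}$ by continuity. Points of $\mathbb{R}^{kn}$ are written $x=(x_1,\dots,x_n)$ with $x_l\in\mathbb{R}^k$. For a polynomial $f$ in $n$ variables over $(\mathbb{R}\otimes_{\mathbb{Q}}K)_B$ put $f^*(x)=f(A^*_{K,B}(x_1),\dots,A^*_{K,B}(x_n))$ and $\phi_f(x)=\operatorname{tr}^*(f^*(x))\in\mathbb{R}$, and let $P_{f,\sigma}\in\mathbb{C}[z_1,\dots,z_n]$ be obtained by applying $\sigma^*$ to every coefficient of $f$. For a smooth, compactly supported $\psi:\mathbb{R}^{kn}\to\mathbb{C}$ define $$I_{K,B,\psi}(f)=\int_{\mathbb{R}^{kn}}e^{2\pi i\phi_f(x)}\psi(x)\,dx,$$ $$H_{f,K,B,\sigma}(x)=\max_{|\alpha|\ge1}\left|\frac1{\alpha!}\,\partial^\alpha P_{f,\sigma}\big(\sigma^{**}(x_1),\dots,\sigma^{**}(x_n)\big)\right|^{1/|\alpha|},\qquad H_{f,K,B,\sigma,\psi}=\inf_{x\in\operatorname{supp}\psi}H_{f,K,B,\sigma}(x),$$ where $\alpha$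 runs over the multi-indices in $\mathbb{Z}_{\ge0}^n$, and, for a set $S$ of embeddings of $K$ into $\mathbb{C}$, $$H_{f,K,B,S,\psi}=\prod_{\sigma\in S}H_{f,K,B,\sigma,\psi}.$$ **Theorem.** Let $n,d\ge0$ be integers and let $\psi:\mathbb{R}^{kn}\to\mathbb{C}$ be smooth and compactly supported. There is a constant $C>0$, depending only on $K$, $B$, $n$, $d$ and $\psi$, such that for every nonzero polynomial $f$ of degree at most $d$ in $n$ variables over $(\mathbb{R}\otimes_{\mathbb{Q}}K)_B$, and every set $S$ of embeddings $K\to\mathbb{C}$ such that $\tau\in S$ if and only if $\overline\tau\in S$, $$|I_{K,B,\psi}(f)|\le C\,H_{f,K,B,S,\psi}^{-1},$$ where the right side is interpreted as $\infty$ if $H_{f,K,B,S,\psi}=0$. (The empty product is $1$, an infimum over the empty set is $\infty$, $\infty^{-1}=0$, and a maximum over the empty set is $0$.) -/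

import Mathlib

open scoped ENNReal NNReal ContDiff

namespace NumberFieldOscillatory

noncomputable section

variable {K : Type*} [Field K] {k n : ℕ}

/-- The matrix `A_{K,B}(q)` of multiplication by `q ∈ K` in the `ℚ`-basis `B`, viewed as a
matrix with real entries. The column index is the input index. -/
def mulMatrix [NumberField K] (B : Module.Basis (Fin k) ℚ K) (q : K) :
    Matrix (Fin k) (Fin k) ℝ :=
  (Algebra.leftMulMatrix B q).map (algebraMap ℚ ℝ)

/-- The extension `A_{K,B}^* : ℝ^k → M_{k × k}(ℝ)` of `𝐪 ↦ A_{K,B}(q₁ ω₁ + ⋯ + q_k ω_k)` from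
`ℚ^k` to `ℝ^k`. The original map is `ℚ`-linear, so its extension by continuity is the `ℝ`-linear
map with the same values on the standard basis; see `mulMatrixStar_ratCast`. -/
def mulMatrixStar [NumberField K] (B : Module.Basis (Fin k) ℚ K) :
    (Fin k → ℝ) →ₗ[ℝ] Matrix (Fin k) (Fin k) ℝ :=
  Fintype.linearCombination ℝ fun j => mulMatrix B (B j)

variable [NumberField K] (B : Module.Basis (Fin k) ℚ K)

theorem mulMatrixStar_apply (x : Fin k → ℝ) :
    mulMatrixStar B x = ∑ j, x j • mulMatrix B (B j) := by
  simp [mulMatrixStar, Fintype.linearCombination_apply]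

theorem mulMatrixStar_ratCast (q : Fin k → ℚ) :
    mulMatrixStar B (fun j => (q j : ℝ)) = mulMatrix B (∑ j, q j • B j) := by
  rw [mulMatrixStar_apply]
  ext a b
  simp [mulMatrix, Matrix.sum_apply, map_sum]

theorem mulMatrixStar_repr (q : K) :
    mulMatrixStar B (fun j => ((B.repr q j : ℚ) : ℝ)) = mulMatrix B q := by
  rw [mulMatrixStar_ratCast, B.sum_repr]

theorem mulMatrix_one : mulMatrix B 1 = 1 := by
  simp [mulMatrix]

theorem mulMatrix_mul (p q : K) : mulMatrix B (p * q) = mulMatrix B p * mulMatrix B q := by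
  simp [mulMatrix, Matrix.map_mul]

theorem mulMatrixStar_mul (x y : Fin k → ℝ) :
    mulMatrixStar B x * mulMatrixStar B y =
      ∑ i, ∑ j, (x i * y j) • mulMatrix B (B i * B j) := by
  rw [mulMatrixStar_apply, mulMatrixStar_apply, Finset.sum_mul_sum]
  simp only [mulMatrix_mul, smul_mul_smul_comm]

/-- The algebra `(ℝ ⊗_ℚ K)_B`: the image of `ℝ^k` under `A_{K,B}^*`, a subalgebra of the real
`k × k` matrices. -/
def realAlg : Subalgebra ℝ (Matrix (Fin k) (Fin k) ℝ) where
  carrier := Set.range (mulMatrixStar B)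
  add_mem' := by
    rintro _ _ ⟨x, rfl⟩ ⟨y, rfl⟩
    exact ⟨x + y, map_add _ _ _⟩
  mul_mem' := by
    rintro _ _ ⟨x, rfl⟩ ⟨y, rfl⟩
    rw [mulMatrixStar_mul]
    change _ ∈ LinearMap.range (mulMatrixStar B)
    refine Submodule.sum_mem _ fun i _ => Submodule.sum_mem _ fun j _ =>
      Submodule.smul_mem _ _ ⟨_, mulMatrixStar_repr B _⟩
  algebraMap_mem' := by
    intro r
    rw [Algebra.algebraMap_eq_smul_one, ← mulMatrix_one B, ← mulMatrixStar_repr]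
    exact ⟨r • _, map_smul _ _ _⟩

/-- `(ℝ ⊗_ℚ K)_B` is commutative, with the operations of the matrix algebra. -/
instance realAlgCommRing : CommRing (realAlg B) :=
  { (inferInstance : Ring (realAlg B)) with
    mul_comm := by
      rintro ⟨_, x, rfl⟩ ⟨_, y, rfl⟩
      apply Subtype.ext
      change mulMatrixStar B x * mulMatrixStar B y = mulMatrixStar B y * mulMatrixStar B x
      rw [mulMatrixStar_mul, mulMatrixStar_mul, Finset.sum_comm]
      simp only [mul_comm] }

/-- `A_{K,B}^*` as a map from `ℝ^k` onto `(ℝ ⊗_ℚ K)_B`. -/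
def toRealAlg (x : Fin k → ℝ) : realAlg B := ⟨mulMatrixStar B x, x, rfl⟩

/-- The inverse of `A_{K,B}^*`: the vector of coordinates of `1 ∈ K` is sent by the matrix
`A_{K,B}(q)` to the vector of coordinates of `q`; see `coords_toRealAlg`. -/
def coords (M : realAlg B) : Fin k → ℝ :=
  (M : Matrix (Fin k) (Fin k) ℝ).mulVec fun j => ((B.repr 1 j : ℚ) : ℝ)

theorem coords_toRealAlg (x : Fin k → ℝ) : coords B (toRealAlg B x) = x := by
  have key : ∀ q : K, (mulMatrix B q).mulVec (fun j => ((B.repr 1 j : ℚ) : ℝ)) =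
      fun j => ((B.repr q j : ℚ) : ℝ) := by
    intro q
    have h := Algebra.leftMulMatrix_mulVec_repr B q 1
    funext i
    have hi := congrFun h i
    rw [mul_one] at hi
    rw [← hi]
    simp [mulMatrix, Matrix.mulVec, dotProduct]
  unfold coords toRealAlg
  simp only [mulMatrixStar_apply, Matrix.sum_mulVec, Matrix.smul_mulVec, key]
  funext i
  simp [Finsupp.single_apply, apply_ite]

theorem toRealAlg_coords (M : realAlg B) : toRealAlg B (coords B M) = M := by
  obtain ⟨_, x, rfl⟩ := M
  exact congrArg (toRealAlg B) (coords_toRealAlg B x)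

/-- The map `σ^{**} : ℝ^k → ℂ`, `𝐱 ↦ x₁ σ(ω₁) + ⋯ + x_k σ(ω_k)`, attached to an embedding
`σ : K → ℂ`. -/
def sigmaStarStar (σ : K →+* ℂ) (x : Fin k → ℝ) : ℂ := ∑ j, (x j : ℂ) * σ (B j)

theorem sigmaStarStar_repr (σ : K →+* ℂ) (q : K) :
    sigmaStarStar B σ (fun j => ((B.repr q j : ℚ) : ℝ)) = σ q := by
  conv_rhs => rw [← B.sum_repr q]
  simp [sigmaStarStar, Algebra.smul_def]

/-- The ring homomorphism `σ^* : (ℝ ⊗_ℚ K)_B → ℂ`, the continuous (that is, `ℝ`-linear)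
extension of `A_{K,B}(q) ↦ σ(q)`. It satisfies `σ^* ∘ A_{K,B}^* = σ^{**}`. -/
def sigmaStar (σ : K →+* ℂ) : realAlg B →+* ℂ where
  toFun M := sigmaStarStar B σ (coords B M)
  map_one' := by
    have h : (1 : realAlg B) = toRealAlg B (fun j => ((B.repr 1 j : ℚ) : ℝ)) :=
      Subtype.ext ((mulMatrix_one B).symm.trans (mulMatrixStar_repr B 1).symm)
    rw [h, coords_toRealAlg, sigmaStarStar_repr, map_one]
  map_zero' := by
    have h : coords B 0 = 0 := Matrix.zero_mulVec _
    rw [h]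
    simp [sigmaStarStar]
  map_add' M N := by
    have h : coords B (M + N) = coords B M + coords B N := Matrix.add_mulVec _ _ _
    rw [h]
    simp [sigmaStarStar, add_mul, Finset.sum_add_distrib]
  map_mul' M N := by
    have hM := toRealAlg_coords B M
    have hN := toRealAlg_coords B N
    set x := coords B M
    set y := coords B N
    have h : coords B (M * N) =
        ∑ i, ∑ j, (x i * y j) • fun l => ((B.repr (B i * B j) l : ℚ) : ℝ) := by
      rw [← coords_toRealAlg B (∑ i, ∑ j, _)]
      congr 1
      rw [← hM, ← hN]
      apply Subtype.ext
      change mulMatrixStar B x * mulMatrixStar B y = mulMatrixStar B _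
      rw [mulMatrixStar_mul]
      simp only [map_sum, map_smul, mulMatrixStar_repr]
    rw [h]
    have hlin : ∀ z : Fin k → ℝ, sigmaStarStar B σ z =
        Fintype.linearCombination ℝ (fun j => σ (B j)) z := by
      intro z
      simp [sigmaStarStar, Fintype.linearCombination_apply]
    rw [hlin]
    simp only [map_sum, map_smul]
    simp only [← hlin, sigmaStarStar_repr, map_mul]
    simp only [sigmaStarStar, Finset.sum_mul_sum]
    refine Finset.sum_congr rfl fun i _ => Finset.sum_congr rfl fun j _ => ?_
    rw [Complex.real_smul]
    push_cast
    ring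

theorem sigmaStar_toRealAlg (σ : K →+* ℂ) (x : Fin k → ℝ) :
    sigmaStar B σ (toRealAlg B x) = sigmaStarStar B σ x := by
  change sigmaStarStar B σ (coords B _) = _
  rw [coords_toRealAlg]

/-- The trace `tr^* : (ℝ ⊗_ℚ K)_B → ℝ`, the continuous extension of the field trace, which is
the matrix trace. -/
def trStar (M : realAlg B) : ℝ := Matrix.trace (M : Matrix (Fin k) (Fin k) ℝ)

/-- `f^*(x) = f(A_{K,B}^*(x₁), …, A_{K,B}^*(x_n))` for `x = (x₁, …, x_n) ∈ (ℝ^k)^n`. -/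
def fStar (f : MvPolynomial (Fin n) (realAlg B)) (x : Fin n → Fin k → ℝ) : realAlg B :=
  MvPolynomial.eval (fun l => toRealAlg B (x l)) f

/-- The phase `φ_f = tr^* ∘ f^*`. -/
def phase (f : MvPolynomial (Fin n) (realAlg B)) (x : Fin n → Fin k → ℝ) : ℝ :=
  trStar B (fStar B f x)

/-- The oscillatory integral `I_{K,B,ψ}(f) = ∫ e^{2πi φ_f(x)} ψ(x) dx` over `ℝ^{kn}`. -/
def oscInt (ψ : (Fin n → Fin k → ℝ) → ℂ) (f : MvPolynomial (Fin n) (realAlg B)) : ℂ :=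
  ∫ x, Complex.exp (2 * Real.pi * Complex.I * (phase B f x : ℂ)) * ψ x

/-- The complex polynomial `P_{f,σ}`: apply `σ^*` to each coefficient of `f`. -/
def conjPoly (f : MvPolynomial (Fin n) (realAlg B)) (σ : K →+* ℂ) : MvPolynomial (Fin n) ℂ :=
  MvPolynomial.map (sigmaStar B σ) f

/-- The iterated partial derivative `∂^α P = ∂₁^{α₁} ⋯ ∂_n^{α_n} P`. -/
def partialDeriv (α : Fin n → ℕ) (P : MvPolynomial (Fin n) ℂ) : MvPolynomial (Fin n) ℂ :=
  (List.finRange n).foldr (fun l Q => (MvPolynomial.pderiv l)^[α l] Q) P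

/-- The pointwise `H`-functional
`H_{f,K,B,σ}(x) = max_{|α| ≥ 1} |(1/α!) ∂^α P_{f,σ}(σ^{**}(x₁), …, σ^{**}(x_n))|^{1/|α|}`.
All but finitely many of the terms vanish. -/
def hPoint (f : MvPolynomial (Fin n) (realAlg B)) (σ : K →+* ℂ) (x : Fin n → Fin k → ℝ) :
    ℝ≥0∞ :=
  ⨆ (α : Fin n → ℕ) (_ : 1 ≤ ∑ l, α l),
    ‖(1 / ((∏ l, (α l).factorial : ℕ) : ℂ)) *
      MvPolynomial.eval (fun l => sigmaStarStar B σ (x l))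
        (partialDeriv α (conjPoly B f σ))‖ₑ ^ (1 / ((∑ l, α l : ℕ) : ℝ))

/-- The uniform `H`-functional `H_{f,K,B,σ,ψ}`: the infimum of `H_{f,K,B,σ}(x)` over
`x ∈ supp ψ` (the closed support). -/
def hUnif (f : MvPolynomial (Fin n) (realAlg B)) (σ : K →+* ℂ)
    (ψ : (Fin n → Fin k → ℝ) → ℂ) : ℝ≥0∞ :=
  ⨅ x ∈ tsupport ψ, hPoint B f σ x

/-- The uniform `H`-functional `H_{f,K,B,S,ψ} = ∏_{σ ∈ S} H_{f,K,B,σ,ψ}` of a set `S` of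
embeddings. -/
def hSet (f : MvPolynomial (Fin n) (realAlg B)) (S : Finset (K →+* ℂ))
    (ψ : (Fin n → Fin k → ℝ) → ℂ) : ℝ≥0∞ :=
  ∏ σ ∈ S, hUnif B f σ ψ

end

end NumberFieldOscillatory

/-! The trace is the sum over all embeddings, so the phase is `∑_v m_v Re P_v(σ_v^{**}(x))`, over
the infinite places `v`, with `m_v = 1` or `2` the real dimension of the completion. The coordinates
belonging to different places can be moved independently. A set `S` closed under conjugation is a
union of full fibres over places, so each of its places must contribute a factor `H_v^{-m_v}`.

At one place let `h` (`scale`) be comparable to the maximum of `1` and of all `|∂^α P_v|^{1/|α|}`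
with `|α| ≥ 2`, and let `M` (`mass`) be comparable to the maximum of `h` and `|∇P_v|`. Then `M`
dominates the pointwise `H`-functional (`hPoint_le_mass`). Differentiating an amplitude along `v`
costs a factor `h`, while integrating by parts against the gradient brings in `1/M`. With
coefficients that stay regular at critical points, one integration by parts multiplies the weight of
the amplitude by the gain `h/M ≤ 1` (`exists_gain_step`). Repeating this bounds the integral by `∫
∏_v (h_v/M_v)^6` over the support (`exists_norm_integral_osc_le`).

This integral is small wherever `M ≥ H`. If `h` is bounded, the gain is `O(1/H)`. Otherwise
polarization yields one of finitely many directions along which a pure derivative of order `j ≥ 2`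
has size about `h^j`. Let `q` be the derivative of `P_v` along a line in that direction. If `δ` is
the distance to the nearest root of `q`, factoring `q` gives `h^j δ^{j-1} ≲ |q| ≲ M`, whence `gain²
≲ 1/(1 + Hδ)` (`exists_root_gain_sq_le`). There are at most `d` roots, so the cube of this bound
integrates over the line to `O(H^{-m_v})`. Averaging over translations along the line
(`lintegral_mul_le_of_average`) transfers the bound to a ball without disturbing the other places,
which are then treated one at a time (`exists_lintegral_prod_cut_le`).

The symbol estimates are uniform over the index `ι`, which is later the set of polynomials of degree
at most `d`; this makes the constant independent of `f`. -/

namespace NumberFieldOscillatory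

noncomputable section

/-! ### Calculus of weighted symbol estimates, uniform in a parameter. -/

section Symbols

variable {V ι J : Type*} [NormedAddCommGroup V] [NormedSpace ℝ V]

/-- Symbol estimates of order `N`: the functions `g i` are smooth, and their iterated derivatives
of order at most `N` along the directions `e j` are bounded, uniformly in `i`, by the weight `w`
times one factor `h j` for each derivative along `e j`. -/
def SymbolBound (e : J → V) (h : J → ι → V → ℝ) :
    ℕ → (ι → V → ℝ) → (ι → V → ℂ) → Prop
  | 0, w, g => (∀ i, ContDiff ℝ ∞ (g i)) ∧ ∃ C : ℝ, 0 ≤ C ∧ ∀ i x, ‖g i x‖ ≤ C * w i x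
  | N + 1, w, g => ((∀ i, ContDiff ℝ ∞ (g i)) ∧ ∃ C : ℝ, 0 ≤ C ∧ ∀ i x, ‖g i x‖ ≤ C * w i x) ∧
      ∀ j, SymbolBound e h N (fun i x => w i x * h j i x) (fun i x => fderiv ℝ (g i) x (e j))

/-- Symbol estimates of all orders. -/
def IsSymbol (e : J → V) (h : J → ι → V → ℝ) (w : ι → V → ℝ) (g : ι → V → ℂ) : Prop :=
  ∀ N, SymbolBound e h N w g

variable {e : J → V} {h : J → ι → V → ℝ} {w w₁ w₂ : ι → V → ℝ} {g g₁ g₂ : ι → V → ℂ} {N : ℕ}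

theorem SymbolBound.zero_order (hg : SymbolBound e h N w g) : SymbolBound e h 0 w g := by
  cases N with
  | zero => exact hg
  | succ N => exact hg.1

theorem SymbolBound.contDiff (hg : SymbolBound e h N w g) (i : ι) : ContDiff ℝ ∞ (g i) :=
  hg.zero_order.1 i

theorem SymbolBound.differentiable (hg : SymbolBound e h N w g) (i : ι) :
    Differentiable ℝ (g i) :=
  (hg.contDiff i).differentiable (by simp)

theorem SymbolBound.of_succ : ∀ {N : ℕ} {w : ι → V → ℝ} {g : ι → V → ℂ},
    SymbolBound e h (N + 1) w g → SymbolBound e h N w g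
  | 0, _, _, hg => hg.1
  | _ + 1, _, _, hg => ⟨hg.1, fun j => (hg.2 j).of_succ⟩

theorem SymbolBound.mono (hh : ∀ j i x, 0 ≤ h j i x) {C : ℝ} (hC : 0 ≤ C) :
    ∀ {N : ℕ} {w₁ w₂ : ι → V → ℝ} {g : ι → V → ℂ}, (∀ i x, w₁ i x ≤ C * w₂ i x) →
      SymbolBound e h N w₁ g → SymbolBound e h N w₂ g := by
  have base : ∀ {w₁ w₂ : ι → V → ℝ} {g : ι → V → ℂ}, (∀ i x, w₁ i x ≤ C * w₂ i x) →
      SymbolBound e h 0 w₁ g → SymbolBound e h 0 w₂ g := by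
    rintro w₁ w₂ g hw ⟨hs, A, hA, hb⟩
    refine ⟨hs, A * C, by positivity, fun i x => (hb i x).trans ?_⟩
    rw [mul_assoc]
    exact mul_le_mul_of_nonneg_left (hw i x) hA
  intro N
  induction N with
  | zero => exact base
  | succ N ih =>
    intro w₁ w₂ g hw hg
    refine ⟨base hw hg.1, fun j => ih (fun i x => ?_) (hg.2 j)⟩
    rw [← mul_assoc]
    exact mul_le_mul_of_nonneg_right (hw i x) (hh j i x)

theorem SymbolBound.add : ∀ {N : ℕ} {w : ι → V → ℝ} {g₁ g₂ : ι → V → ℂ},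
    SymbolBound e h N w g₁ → SymbolBound e h N w g₂ →
      SymbolBound e h N w (fun i x => g₁ i x + g₂ i x) := by
  have base : ∀ {w : ι → V → ℝ} {g₁ g₂ : ι → V → ℂ},
    SymbolBound e h 0 w g₁ → SymbolBound e h 0 w g₂ →
      SymbolBound e h 0 w (fun i x => g₁ i x + g₂ i x) := by
    rintro w g₁ g₂ ⟨s₁, A, hA, b₁⟩ ⟨s₂, B, hB, b₂⟩
    refine ⟨fun i => (s₁ i).add (s₂ i), A + B, by positivity, fun i x => ?_⟩
    rw [add_mul]
    exact (norm_add_le _ _).trans (add_le_add (b₁ i x) (b₂ i x))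
  intro N
  induction N with
  | zero => exact base
  | succ N ih =>
    intro w g₁ g₂ h₁ h₂
    refine ⟨base h₁.1 h₂.1, fun j => ?_⟩
    convert ih (h₁.2 j) (h₂.2 j) using 3 with i x
    rw [fderiv_fun_add (h₁.differentiable i x) (h₂.differentiable i x)]
    rfl

theorem SymbolBound.mul (hh : ∀ j i x, 0 ≤ h j i x) :
    ∀ {N : ℕ} {w₁ w₂ : ι → V → ℝ} {g₁ g₂ : ι → V → ℂ},
    SymbolBound e h N w₁ g₁ → SymbolBound e h N w₂ g₂ →
      SymbolBound e h N (fun i x => w₁ i x * w₂ i x) (fun i x => g₁ i x * g₂ i x) := by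
  have base : ∀ {w₁ w₂ : ι → V → ℝ} {g₁ g₂ : ι → V → ℂ},
    SymbolBound e h 0 w₁ g₁ → SymbolBound e h 0 w₂ g₂ →
      SymbolBound e h 0 (fun i x => w₁ i x * w₂ i x) (fun i x => g₁ i x * g₂ i x) := by
    rintro w₁ w₂ g₁ g₂ ⟨s₁, A, hA, b₁⟩ ⟨s₂, B, hB, b₂⟩
    refine ⟨fun i => (s₁ i).mul (s₂ i), A * B, by positivity, fun i x => ?_⟩
    rw [norm_mul, mul_mul_mul_comm]
    exact mul_le_mul (b₁ i x) (b₂ i x) (norm_nonneg _) ((norm_nonneg _).trans (b₁ i x))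
  intro N
  induction N with
  | zero => exact base
  | succ N ih =>
    intro w₁ w₂ g₁ g₂ h₁ h₂
    refine ⟨base h₁.1 h₂.1, fun j => ?_⟩
    have a₁ := ih h₁.of_succ (h₂.2 j)
    have a₂ := ih (h₁.2 j) h₂.of_succ
    have a₁' := a₁.mono (w₂ := fun i x => w₁ i x * w₂ i x * h j i x) hh zero_le_one
      (fun i x => le_of_eq (by ring))
    have a₂' := a₂.mono (w₂ := fun i x => w₁ i x * w₂ i x * h j i x) hh zero_le_one
      (fun i x => le_of_eq (by ring))
    convert a₁'.add a₂' using 3 with i x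
    rw [fderiv_fun_mul (h₁.differentiable i x) (h₂.differentiable i x)]
    simp [mul_comm]

theorem symbolBound_zero (N : ℕ) (w : ι → V → ℝ) : SymbolBound e h N w (fun _ _ => 0) := by
  induction N generalizing w with
  | zero => exact ⟨fun _ => contDiff_const, 0, le_rfl, by simp⟩
  | succ N ih =>
    exact ⟨⟨fun _ => contDiff_const, 0, le_rfl, by simp⟩, fun j => by simpa using ih _⟩

theorem symbolBound_const (N : ℕ) (c : ℂ) :
    SymbolBound e h N (fun _ _ => 1) (fun _ _ => c) := by
  cases N with
  | zero => exact ⟨fun _ => contDiff_const, ‖c‖, norm_nonneg _, by simp⟩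
  | succ N =>
    exact ⟨⟨fun _ => contDiff_const, ‖c‖, norm_nonneg _, by simp⟩,
      fun j => by simpa using symbolBound_zero _ _⟩

/-- The derivative of `1 / g` is `-g' * (1 / g) ^ 2`, of weight `w * h * w⁻¹ ^ 2 = w⁻¹ * h`, so
induction on the order applies. The lower bound on `g` must match its upper weight. -/
theorem SymbolBound.inv (hh : ∀ j i x, 0 ≤ h j i x) {c : ℝ} (hc : 0 < c)
    (hw : ∀ i x, 0 < w i x) (hD : ∀ i x, c * w i x ≤ ‖g i x‖) :
    ∀ {N : ℕ}, SymbolBound e h N w g →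
      SymbolBound e h N (fun i x => (w i x)⁻¹) (fun i x => (g i x)⁻¹) := by
  have hg0 : ∀ i x, g i x ≠ 0 := fun i x =>
    norm_pos_iff.1 ((mul_pos hc (hw i x)).trans_le (hD i x))
  have base : SymbolBound e h 0 w g →
      SymbolBound e h 0 (fun i x => (w i x)⁻¹) (fun i x => (g i x)⁻¹) := by
    rintro ⟨s, -⟩
    refine ⟨fun i => (s i).inv (hg0 i), c⁻¹, by positivity, fun i x => ?_⟩
    rw [norm_inv, ← mul_inv]
    exact inv_anti₀ (mul_pos hc (hw i x)) (hD i x)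
  intro N
  induction N with
  | zero => exact base
  | succ N ih =>
    intro h₁
    refine ⟨base h₁.1, fun j => ?_⟩
    have a := ih h₁.of_succ
    have b := (((symbolBound_const N (-1)).mul hh (h₁.2 j)).mul hh (a.mul hh a)).mono
      (w₂ := fun i x => (w i x)⁻¹ * h j i x) hh zero_le_one
      (fun i x => le_of_eq (by have := (hw i x).ne'; field_simp))
    convert b using 3 with i x
    have hd := ((hasFDerivAt_inv' (𝕜 := ℝ) (hg0 i x)).comp x
      (h₁.differentiable i x).hasFDerivAt).fderiv
    simp only [Function.comp_def] at hd
    rw [hd]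
    simp
    ring

theorem isSymbol_zero (w : ι → V → ℝ) : IsSymbol e h w (fun _ _ => 0) :=
  fun N => symbolBound_zero N w

theorem isSymbol_const (c : ℂ) : IsSymbol e h (fun _ _ => 1) (fun _ _ => c) :=
  fun N => symbolBound_const N c

theorem IsSymbol.contDiff (hg : IsSymbol e h w g) (i : ι) : ContDiff ℝ ∞ (g i) :=
  (hg 0).contDiff i

theorem IsSymbol.bound (hg : IsSymbol e h w g) :
    ∃ C : ℝ, 0 ≤ C ∧ ∀ i x, ‖g i x‖ ≤ C * w i x :=
  (hg 0).2

theorem IsSymbol.mono (hh : ∀ j i x, 0 ≤ h j i x) {C : ℝ} (hC : 0 ≤ C)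
    (hw : ∀ i x, w₁ i x ≤ C * w₂ i x) (hg : IsSymbol e h w₁ g) : IsSymbol e h w₂ g :=
  fun N => (hg N).mono hh hC hw

theorem IsSymbol.of_le (hh : ∀ j i x, 0 ≤ h j i x)
    (hw : ∀ i x, w₁ i x ≤ w₂ i x) (hg : IsSymbol e h w₁ g) : IsSymbol e h w₂ g :=
  hg.mono hh zero_le_one (by simpa using hw)

theorem IsSymbol.add (h₁ : IsSymbol e h w g₁) (h₂ : IsSymbol e h w g₂) :
    IsSymbol e h w (fun i x => g₁ i x + g₂ i x) :=
  fun N => (h₁ N).add (h₂ N)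

theorem IsSymbol.mul (hh : ∀ j i x, 0 ≤ h j i x) (h₁ : IsSymbol e h w₁ g₁)
    (h₂ : IsSymbol e h w₂ g₂) :
    IsSymbol e h (fun i x => w₁ i x * w₂ i x) (fun i x => g₁ i x * g₂ i x) :=
  fun N => (h₁ N).mul hh (h₂ N)

theorem IsSymbol.const_mul (hh : ∀ j i x, 0 ≤ h j i x) (c : ℂ) (hg : IsSymbol e h w g) :
    IsSymbol e h w (fun i x => c * g i x) := by
  simpa using (isSymbol_const c).mul hh hg

theorem IsSymbol.inv (hh : ∀ j i x, 0 ≤ h j i x) {c : ℝ} (hc : 0 < c)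
    (hw : ∀ i x, 0 < w i x) (hD : ∀ i x, c * w i x ≤ ‖g i x‖) (hg : IsSymbol e h w g) :
    IsSymbol e h (fun i x => (w i x)⁻¹) (fun i x => (g i x)⁻¹) :=
  fun N => (hg N).inv hh hc hw hD

theorem IsSymbol.deriv (hg : IsSymbol e h w g) (j : J) :
    IsSymbol e h (fun i x => w i x * h j i x) (fun i x => fderiv ℝ (g i) x (e j)) :=
  fun N => (hg (N + 1)).2 j

theorem IsSymbol.sum {β : Type*} (s : Finset β) {G : β → ι → V → ℂ}
    (hG : ∀ b ∈ s, IsSymbol e h w (G b)) : IsSymbol e h w (fun i x => ∑ b ∈ s, G b i x) := by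
  classical
  induction s using Finset.induction_on with
  | empty => simpa using isSymbol_zero w
  | insert b s hb ih =>
    simp only [Finset.sum_insert hb]
    exact (hG b (by simp)).add (ih fun c hc => hG c (by simp [hc]))

theorem IsSymbol.pow (hh : ∀ j i x, 0 ≤ h j i x) (hg : IsSymbol e h w g) (p : ℕ) :
    IsSymbol e h (fun i x => w i x ^ p) (fun i x => g i x ^ p) := by
  induction p with
  | zero => simpa using isSymbol_const 1
  | succ p ih => simpa only [pow_succ] using ih.mul hh hg

theorem IsSymbol.conj (hg : IsSymbol e h w g) :
    IsSymbol e h w (fun i x => (starRingEnd ℂ) (g i x)) := by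
  intro N
  have hN := hg N
  clear hg
  have base : ∀ {w : ι → V → ℝ} {g : ι → V → ℂ}, SymbolBound e h 0 w g →
      SymbolBound e h 0 w (fun i x => (starRingEnd ℂ) (g i x)) := by
    rintro w g ⟨s, A, hA, hb⟩
    exact ⟨fun i => Complex.conjCLE.contDiff.comp (s i), A, hA, by simpa using hb⟩
  induction N generalizing w g with
  | zero => exact base hN
  | succ N ih =>
    refine ⟨base hN.1, fun j => ?_⟩
    convert ih (hN.2 j) using 3 with i x
    have := (Complex.conjCLE.toContinuousLinearMap.hasFDerivAt (x := g i x)).comp x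
      (hN.differentiable i x).hasFDerivAt
    have h2 := this.fderiv
    simp only [Function.comp_def] at h2
    erw [h2]
    rfl

/-- A smooth compactly supported function satisfies symbol estimates when the `h j` are at least
`1`. -/
theorem isSymbol_of_hasCompactSupport (hh : ∀ j i x, 1 ≤ h j i x) {ψ : V → ℂ}
    (hψ : ContDiff ℝ ∞ ψ) (hc : HasCompactSupport ψ) :
    IsSymbol e h (fun _ _ => 1) (fun _ => ψ) := by
  intro N
  have base : ∀ {ψ : V → ℂ}, ContDiff ℝ ∞ ψ → HasCompactSupport ψ →
      SymbolBound e h 0 (fun _ _ => 1) (fun _ => ψ) := by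
    intro ψ hψ hc
    obtain ⟨C, hC⟩ := hψ.continuous.bounded_above_of_compact_support hc
    exact ⟨fun _ => hψ, max C 0, le_max_right _ _, fun i x => by simpa using Or.inl (hC x)⟩
  induction N generalizing ψ with
  | zero => exact base hψ hc
  | succ N ih =>
    refine ⟨base hψ hc, fun j => ?_⟩
    -- The derivative is again a fixed bump, of weight `1`; the extra factor `h j` is free because
    -- it is at least `1`.
    refine SymbolBound.mono (w₁ := fun _ _ => 1) (fun j i x => zero_le_one.trans (hh j i x))
      zero_le_one (fun i x => by simpa using hh j i x) (ih (ψ := fun x => fderiv ℝ ψ x (e j)) ?_ ?_)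
    · exact (hψ.fderiv_right (m := ∞) (by simp)).clm_apply contDiff_const
    · exact hc.fderiv_apply ℝ (e j)

end Symbols


/-! ### Polarization of products into powers. -/

section Polarization

open Finset

/-- Polarization: a product of `j` elements of a commutative ring is, up to a positive integer
factor, an alternating sum of `j`-th powers of partial sums. -/
theorem exists_polarization (j : ℕ) : ∃ c : ℕ, 1 ≤ c ∧ ∀ {R : Type*} [CommRing R] (x : Fin j → R)
    (ev : R →+ ℂ), (c : ℂ) * ev (∏ i, x i) =
      ∑ A ∈ (univ : Finset (Fin j)).powerset, (-1) ^ (j + #A) * ev ((∑ a ∈ A, x a) ^ j) := by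
  classical
  -- The integer is the number of permutations; only its positivity matters later.
  refine ⟨#{f : Fin j → Fin j | Function.Bijective f},
    card_pos.2 ⟨id, mem_filter.2 ⟨mem_univ _, Function.bijective_id⟩⟩, fun {R} _ x ev => ?_⟩
  have expand : ∀ A : Finset (Fin j), (∑ a ∈ A, x a) ^ j =
      ∑ f : Fin j → Fin j, if ∀ i, f i ∈ A then ∏ i, x (f i) else 0 := by
    intro A
    have h := prod_univ_sum (fun _ : Fin j => A) (fun _ a => x a)
    simp only [prod_const, card_univ, Fintype.card_fin] at h
    rw [h, ← sum_filter]
    refine sum_congr ?_ fun _ _ => rfl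
    ext f
    simp [Fintype.mem_piFinset]
  -- Inclusion-exclusion: the alternating sum over the sets containing the image of `f` factors as
  -- the product over `a` of `-1 + [a ∉ image f]`, which vanishes unless `f` is surjective.
  have alt : ∀ f : Fin j → Fin j,
      (∑ A ∈ (univ : Finset (Fin j)).powerset, (-1 : R) ^ #A * if ∀ i, f i ∈ A then 1 else 0) =
        if Function.Bijective f then (-1) ^ j else 0 := by
    intro f
    have h := prod_add (fun _ : Fin j => (-1 : R)) (fun a => if a ∈ univ.image f then 0 else 1) univ
    have h' : ∀ A : Finset (Fin j), (∏ a ∈ univ \ A, if a ∈ univ.image f then (0 : R) else 1) =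
        if ∀ i, f i ∈ A then 1 else 0 := by
      intro A
      split_ifs with hA
      · refine prod_eq_one fun a ha => if_neg fun hc => ?_
        obtain ⟨i, -, rfl⟩ := mem_image.1 hc
        exact (mem_sdiff.1 ha).2 (hA i)
      · push Not at hA
        obtain ⟨i, hi⟩ := hA
        exact prod_eq_zero (i := f i) (by simpa using hi) (by simp)
    simp only [prod_const, h'] at h
    rw [← h]
    split_ifs with hf
    · refine (prod_congr rfl (g := fun _ => (-1 : R)) fun a _ => ?_).trans (by simp)
      obtain ⟨i, hi⟩ := hf.2 a
      rw [if_pos (mem_image.2 ⟨i, mem_univ _, hi⟩), add_zero]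
    · have : ¬ Function.Surjective f := fun hs => hf (Finite.surjective_iff_bijective.1 hs)
      simp only [Function.Surjective, not_forall] at this
      obtain ⟨a, ha⟩ := this
      refine prod_eq_zero (mem_univ a) ?_
      rw [if_neg (by simpa using ha), neg_add_cancel]
  have perm : ∀ f : Fin j → Fin j, Function.Bijective f → ∏ i, x (f i) = ∏ i, x i := fun f hf =>
    Fintype.prod_bijective f hf _ _ fun _ => rfl
  have main : ((#{f : Fin j → Fin j | Function.Bijective f} : ℕ) : R) * ∏ i, x i =
      ∑ A ∈ (univ : Finset (Fin j)).powerset, (-1) ^ (j + #A) * (∑ a ∈ A, x a) ^ j := by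
    calc ((#{f : Fin j → Fin j | Function.Bijective f} : ℕ) : R) * ∏ i, x i
        = ∑ f : Fin j → Fin j, (-1) ^ j * ((if Function.Bijective f then (-1) ^ j else 0) *
            ∏ i, x (f i)) := by
          rw [← nsmul_eq_mul, ← sum_const, sum_filter]
          refine sum_congr rfl fun f _ => ?_
          split_ifs with hf
          · rw [perm f hf, ← mul_assoc, ← mul_pow]
            simp
          · simp
      _ = _ := by
          simp only [← alt, expand, mul_sum, sum_mul]
          rw [sum_comm]
          refine sum_congr rfl fun A _ => sum_congr rfl fun f _ => ?_
          split_ifs <;> ring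
  rw [← nsmul_eq_mul, ← map_nsmul, nsmul_eq_mul, main, map_sum]
  refine sum_congr rfl fun A _ => ?_
  rcases Nat.even_or_odd (j + #A) with h | h <;> simp [h.neg_one_pow]

end Polarization

/-! ### Derivatives along words and along lines; roots of one-variable polynomials. -/

section Lines

open MvPolynomial

variable {n : ℕ}

/-- The iterated partial derivative of `P` along a word of coordinates. -/
def wordDeriv (w : List (Fin n)) (P : MvPolynomial (Fin n) ℂ) : MvPolynomial (Fin n) ℂ :=
  w.foldr (fun l Q => pderiv l Q) P

theorem wordDeriv_cons (l : Fin n) (w : List (Fin n)) (P : MvPolynomial (Fin n) ℂ) :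
    wordDeriv (l :: w) P = pderiv l (wordDeriv w P) := rfl

theorem degree_add_length_le_of_coeff_wordDeriv (P : MvPolynomial (Fin n) ℂ) (w : List (Fin n))
    (m : Fin n →₀ ℕ) (hm : coeff m (wordDeriv w P) ≠ 0) :
    (m.sum fun _ e => e) + w.length ≤ P.totalDegree := by
  induction w generalizing m with
  | nil => simpa [wordDeriv] using le_totalDegree (mem_support_iff.2 hm)
  | cons l w ih =>
    rw [wordDeriv_cons, coeff_pderiv] at hm
    have := ih _ (left_ne_zero_of_mul hm)
    rw [Finsupp.sum_add_index' (by simp) (by simp), Finsupp.sum_single_index rfl] at this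
    simp only [List.length_cons]
    omega

theorem wordDeriv_eq_zero {P : MvPolynomial (Fin n) ℂ} {w : List (Fin n)}
    (h : P.totalDegree < w.length) : wordDeriv w P = 0 := by
  ext m
  by_contra hm
  have := degree_add_length_le_of_coeff_wordDeriv P w m (by simpa using hm)
  omega

/-- The derivation `∑ η_l ∂_l`. -/
def dirDeriv (η : Fin n → ℂ) : Derivation ℂ (MvPolynomial (Fin n) ℂ) (MvPolynomial (Fin n) ℂ) :=
  mkDerivation ℂ fun l => C (η l)

theorem dirDeriv_sum_single {j : ℕ} (w : Fin j → Fin n) (A : Finset (Fin j))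
    (P : MvPolynomial (Fin n) ℂ) :
    dirDeriv (∑ a ∈ A, Pi.single (w a) 1) P = ∑ a ∈ A, pderiv (w a) P := by
  classical
  induction P using MvPolynomial.induction_on with
  | C a => simp
  | add p q hp hq => simp [hp, hq, Finset.sum_add_distrib]
  | mul_X p l hp =>
    simp only [Derivation.leibniz, hp, Finset.sum_add_distrib, smul_eq_mul, Finset.mul_sum]
    congr 1
    simp only [dirDeriv, mkDerivation_X, Finset.sum_apply, map_sum, Finset.mul_sum]
    refine Finset.sum_congr rfl fun a _ => ?_
    rcases eq_or_ne (w a) l with h | h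
    · simp [h]
    · simp [h.symm, pderiv_X_of_ne h.symm]

theorem pderiv_comm (l l' : Fin n) (P : MvPolynomial (Fin n) ℂ) :
    pderiv l (pderiv l' P) = pderiv l' (pderiv l P) := by
  ext m
  simp only [coeff_pderiv]
  rcases eq_or_ne l l' with rfl | h
  · rfl
  · rw [add_right_comm]
    simp [h, h.symm]
    ring

-- Partial derivatives commute, so they generate a commutative algebra of operators in which
-- polarization applies: a mixed derivative is an alternating sum of pure directional ones. There
-- are `2 ^ j` summands, so one of them is at least the average.
open scoped IsMulCommutative in
theorem exists_norm_wordDeriv_le {j : ℕ} (w : Fin j → Fin n) (P : MvPolynomial (Fin n) ℂ)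
    (y : Fin n → ℂ) : ∃ A : Finset (Fin j), ‖eval y (wordDeriv (List.ofFn w) P)‖ ≤
      2 ^ j * ‖eval y ((dirDeriv (∑ a ∈ A, Pi.single (w a) 1))^[j] P)‖ := by
  classical
  obtain ⟨c, hc, hpol⟩ := exists_polarization j
  let T : Fin n → Module.End ℂ (MvPolynomial (Fin n) ℂ) := fun l => (pderiv l : Derivation ℂ _ _).toLinearMap
  have hcomm : ∀ a ∈ Set.range T, ∀ b ∈ Set.range T, a * b = b * a := by
    rintro _ ⟨l, rfl⟩ _ ⟨l', rfl⟩
    exact LinearMap.ext fun P => pderiv_comm l l' P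
  have := Algebra.isMulCommutative_adjoin ℂ hcomm
  let x : Fin j → Algebra.adjoin ℂ (Set.range T) := fun i =>
    ⟨T (w i), Algebra.subset_adjoin ⟨_, rfl⟩⟩
  let ev : Algebra.adjoin ℂ (Set.range T) →+ ℂ :=
    { toFun := fun a => eval y ((a : Module.End ℂ (MvPolynomial (Fin n) ℂ)) P)
      map_zero' := by simp
      map_add' := by simp }
  have h := hpol x ev
  have hprod : ev (∏ i, x i) = eval y (wordDeriv (List.ofFn w) P) := by
    change eval y (((∏ i, x i : Algebra.adjoin ℂ (Set.range T)) : Module.End ℂ (MvPolynomial (Fin n) ℂ)) P) = _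
    rw [← List.prod_ofFn]
    congr 1
    have key : ∀ u : List (Fin n), ∀ z : List (Algebra.adjoin ℂ (Set.range T)),
        z.map Subtype.val = u.map T → ((z.prod : Algebra.adjoin ℂ (Set.range T)) : Module.End ℂ (MvPolynomial (Fin n) ℂ)) P =
          wordDeriv u P := by
      intro u
      induction u with
      | nil => intro z hz
               obtain rfl := List.map_eq_nil_iff.1 hz
               rfl
      | cons l u ih =>
        intro z hz
        cases z with
        | nil => simp at hz
        | cons a z =>
          simp only [List.map_cons, List.cons.injEq] at hz
          rw [List.prod_cons, wordDeriv_cons, ← ih z hz.2]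
          change (a : Module.End ℂ (MvPolynomial (Fin n) ℂ)) _ = _
          rw [hz.1]
          rfl
    refine key _ _ ?_
    simp [x, List.map_ofFn, Function.comp_def]
  have hsum : ∀ A : Finset (Fin j), ev ((∑ a ∈ A, x a) ^ j) =
      eval y ((dirDeriv (∑ a ∈ A, Pi.single (w a) 1))^[j] P) := by
    intro A
    change eval y ((((∑ a ∈ A, x a) ^ j : Algebra.adjoin ℂ (Set.range T)) : Module.End ℂ (MvPolynomial (Fin n) ℂ)) P) = _
    have h1 : (((∑ a ∈ A, x a) ^ j : Algebra.adjoin ℂ (Set.range T)) : Module.End ℂ (MvPolynomial (Fin n) ℂ)) =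
        (dirDeriv (∑ a ∈ A, Pi.single (w a) 1)).toLinearMap ^ j := by
      rw [SubmonoidClass.coe_pow]
      congr 1
      refine LinearMap.ext fun P => ?_
      simp [dirDeriv_sum_single, x, T, LinearMap.sum_apply]
    rw [h1, Module.End.pow_apply]
    rfl
  -- If every summand were too small, the `2 ^ j` of them together could not reach the left side.
  by_contra! hcon
  rw [hprod] at h
  simp only [hsum] at h
  have h3 : ‖eval y (wordDeriv (List.ofFn w) P)‖ ≤
      ∑ A ∈ (Finset.univ : Finset (Fin j)).powerset,
        ‖eval y ((dirDeriv (∑ a ∈ A, Pi.single (w a) 1))^[j] P)‖ := by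
    calc _ ≤ (c : ℝ) * ‖eval y (wordDeriv (List.ofFn w) P)‖ :=
          le_mul_of_one_le_left (norm_nonneg _) (by exact_mod_cast hc)
      _ = ‖(c : ℂ) * eval y (wordDeriv (List.ofFn w) P)‖ := by simp
      _ ≤ _ := by
        rw [h]
        exact (norm_sum_le _ _).trans_eq (Finset.sum_congr rfl fun A _ => by simp)
  have h4 : ∑ A ∈ (Finset.univ : Finset (Fin j)).powerset,
      2 ^ j * ‖eval y ((dirDeriv (∑ a ∈ A, Pi.single (w a) 1))^[j] P)‖ <
      ∑ A ∈ (Finset.univ : Finset (Fin j)).powerset, ‖eval y (wordDeriv (List.ofFn w) P)‖ :=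
    Finset.sum_lt_sum_of_nonempty ⟨∅, by simp⟩ fun A _ => hcon A
  rw [← Finset.mul_sum, Finset.sum_const, Finset.card_powerset, Finset.card_univ,
    Fintype.card_fin, nsmul_eq_mul] at h4
  push_cast at h4
  have := lt_of_mul_lt_mul_left h4 (by positivity)
  linarith

/-- The restriction of a polynomial to the line `t ↦ y + t η`. -/
def lineMap (y η : Fin n → ℂ) : MvPolynomial (Fin n) ℂ →ₐ[ℂ] Polynomial ℂ :=
  aeval fun l => Polynomial.C (y l) + Polynomial.C (η l) * Polynomial.X

theorem eval_lineMap (y η : Fin n → ℂ) (P : MvPolynomial (Fin n) ℂ) (t : ℂ) :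
    (lineMap y η P).eval t = eval (fun l => y l + t * η l) P := by
  induction P using MvPolynomial.induction_on with
  | C a => simp [lineMap]
  | add p q hp hq => simp [hp, hq]
  | mul_X p l hp => rw [map_mul, Polynomial.eval_mul, hp]; simp [lineMap, mul_comm t]

theorem derivative_lineMap (y η : Fin n → ℂ) (P : MvPolynomial (Fin n) ℂ) :
    Polynomial.derivative (lineMap y η P) = lineMap y η (dirDeriv η P) := by
  induction P using MvPolynomial.induction_on with
  | C a => simp [lineMap]
  | add p q hp hq => simp [hp, hq]
  | mul_X p l hp =>
    rw [map_mul, Polynomial.derivative_mul, hp, Derivation.leibniz]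
    simp [lineMap, dirDeriv, mkDerivation_X]
    ring

theorem iterate_derivative_lineMap (y η : Fin n → ℂ) (P : MvPolynomial (Fin n) ℂ) (j : ℕ) :
    Polynomial.derivative^[j] (lineMap y η P) = lineMap y η ((dirDeriv η)^[j] P) := by
  induction j generalizing P with
  | zero => rfl
  | succ j ih => rw [Function.iterate_succ_apply, derivative_lineMap, ih,
      Function.iterate_succ_apply]

theorem natDegree_lineMap_le (y η : Fin n → ℂ) (P : MvPolynomial (Fin n) ℂ) :
    (lineMap y η P).natDegree ≤ P.totalDegree := by
  rw [lineMap, aeval_def, eval₂_eq']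
  refine Polynomial.natDegree_sum_le_of_forall_le _ _ fun m hm => ?_
  refine (Polynomial.natDegree_C_mul_le _ _).trans ?_
  refine (Polynomial.natDegree_prod_le _ _).trans ?_
  refine le_trans ?_ (le_totalDegree hm)
  rw [Finsupp.sum_fintype _ _ (by simp)]
  refine Finset.sum_le_sum fun l _ => ?_
  refine Polynomial.natDegree_pow_le.trans ?_
  refine (Nat.mul_le_mul_left _ (m := 1) ?_).trans_eq (mul_one _)
  compute_degree

/-- Away from the roots of a polynomial, its higher derivatives are controlled by its value. -/
theorem norm_iterate_derivative_le (q : Polynomial ℂ) (t : ℂ) {δ : ℝ} (hδ : 0 < δ)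
    (hq : ∀ z ∈ q.roots, δ ≤ ‖t - z‖) (i : ℕ) :
    ‖(Polynomial.derivative^[i] q).eval t‖ * δ ^ i ≤ (q.natDegree : ℝ) ^ i * ‖q.eval t‖ := by
  let pr : Multiset ℂ → Polynomial ℂ := fun s => (s.map fun z => Polynomial.X - Polynomial.C z).prod
  let ev : ℕ → Polynomial ℂ →+ ℂ := fun i =>
    { toFun := fun p => (Polynomial.derivative^[i] p).eval t
      map_zero' := by simp
      map_add' := by simp }
  -- Differentiating a product of linear factors gives a sum over the omitted factor. Each omitted
  -- factor is at least `δ` in absolute value, so each derivative costs at most the number of roots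
  -- divided by `δ`.
  have key : ∀ (i : ℕ) (s : Multiset ℂ), (∀ z ∈ s, δ ≤ ‖t - z‖) →
      ‖ev i (pr s)‖ * δ ^ i ≤ (s.card : ℝ) ^ i * ‖(pr s).eval t‖ := by
    intro i
    induction i with
    | zero => intro s _; simp [ev]
    | succ i ih =>
      intro s hs
      have e1 : ev (i + 1) (pr s) = (s.map fun z => ev i (pr (s.erase z))).sum := by
        change (Polynomial.derivative^[i + 1] (pr s)).eval t = _
        rw [Function.iterate_succ_apply, Polynomial.derivative_prod]
        change ev i _ = _
        rw [map_multiset_sum, Multiset.map_map]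
        simp [pr]
      have e2 : ∀ z ∈ s, ‖ev i (pr (s.erase z))‖ * δ ^ (i + 1) ≤
          (s.card : ℝ) ^ i * ‖(pr s).eval t‖ := by
        intro z hz
        have h1 := ih (s.erase z) fun u hu => hs u (Multiset.mem_of_mem_erase hu)
        have h2 : (pr s).eval t = (t - z) * (pr (s.erase z)).eval t := by
          conv_lhs => rw [← Multiset.cons_erase hz]
          simp [pr]
        have h3 : ((s.erase z).card : ℝ) ≤ s.card := by
          exact_mod_cast Multiset.card_le_card (Multiset.erase_le z s)
        calc ‖ev i (pr (s.erase z))‖ * δ ^ (i + 1)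
            = (‖ev i (pr (s.erase z))‖ * δ ^ i) * δ := by ring
          _ ≤ (((s.erase z).card : ℝ) ^ i * ‖(pr (s.erase z)).eval t‖) * ‖t - z‖ := by
              gcongr
              exact hs z hz
          _ ≤ ((s.card : ℝ) ^ i * ‖(pr (s.erase z)).eval t‖) * ‖t - z‖ := by gcongr
          _ = _ := by rw [h2, norm_mul]; ring
      calc ‖ev (i + 1) (pr s)‖ * δ ^ (i + 1)
          ≤ (s.map fun z => ‖ev i (pr (s.erase z))‖).sum * δ ^ (i + 1) := by
            rw [e1]
            gcongr
            simpa [Function.comp_def] using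
              norm_multiset_sum_le (E := ℂ) (s.map fun z => ev i (pr (s.erase z)))
        _ = (s.map fun z => ‖ev i (pr (s.erase z))‖ * δ ^ (i + 1)).sum := by
            rw [Multiset.sum_map_mul_right]
        _ ≤ (s.map fun _ => (s.card : ℝ) ^ i * ‖(pr s).eval t‖).sum :=
            Multiset.sum_map_le_sum_map _ _ e2
        _ = _ := by simp; ring
  have hfac := IsAlgClosed.splits q |>.eq_prod_roots
  have hcard : q.roots.card = q.natDegree := (IsAlgClosed.splits q).natDegree_eq_card_roots.symm
  have hk := key i q.roots hq
  rw [hcard] at hk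
  have h1 : (Polynomial.derivative^[i] q).eval t = q.leadingCoeff * ev i (pr q.roots) := by
    conv_lhs => rw [hfac, Polynomial.iterate_derivative_C_mul]
    simp [ev, pr]
  have h2 : q.eval t = q.leadingCoeff * (pr q.roots).eval t := by
    conv_lhs => rw [hfac]
    simp [pr]
  rw [h1, h2, norm_mul, norm_mul, mul_assoc, mul_left_comm _ ‖q.leadingCoeff‖]
  exact mul_le_mul_of_nonneg_left hk (norm_nonneg q.leadingCoeff)

end Lines


/-! ### Phase systems: scale, mass, gain and their symbol estimates. -/

section PhaseSystem

open MvPolynomial Finset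

/-- A family, indexed by `ι`, of polynomial phases `∑_v μ_v Re P_v(Λ_v x)` on a real vector space
`V`, where the `P_v` have degree at most `d`. The vectors `e v l c` are dual to the coordinates of
the maps `Λ_v`; the maps `proj v` account for the places at which the coordinates are real. -/
structure PhaseSystem (V ι 𝒱 : Type*) [NormedAddCommGroup V] [NormedSpace ℝ V] (n d : ℕ) where
  Λ : 𝒱 → V →L[ℝ] (Fin n → ℂ)
  e : 𝒱 → Fin n → ℂ →ₗ[ℝ] V
  proj : 𝒱 → ℂ → ℂ
  Λ_e_same : ∀ v l c, Λ v (e v l c) = Pi.single l (proj v c)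
  Λ_e_ne : ∀ v v' l c, v ≠ v' → Λ v' (e v l c) = 0
  P : ι → 𝒱 → MvPolynomial (Fin n) ℂ
  deg_le : ∀ i v, (P i v).totalDegree ≤ d
  μ : 𝒱 → ℝ
  μ_ne : ∀ v, μ v ≠ 0
  re_proj_mul : ∀ i v l c x, (proj v c * eval (Λ v x) (pderiv l (P i v))).re =
    (c * eval (Λ v x) (pderiv l (P i v))).re

theorem hasFDerivAt_eval {n : ℕ} (P : MvPolynomial (Fin n) ℂ) (z : Fin n → ℂ) :
    HasFDerivAt (𝕜 := ℝ) (fun z => eval z P)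
      (∑ l, eval z (pderiv l P) • (ContinuousLinearMap.proj (R := ℝ) (φ := fun _ : Fin n => ℂ) l))
      z := by
  induction P using MvPolynomial.induction_on with
  | C a =>
    simp only [eval_C]
    refine (hasFDerivAt_const (𝕜 := ℝ) a z).congr_fderiv ?_
    ext v
    simp
  | add p q hp hq =>
    simp only [map_add]
    refine (hp.fun_add hq).congr_fderiv ?_
    ext v
    simp [add_mul, sum_add_distrib]
  | mul_X p l hp =>
    have h := hp.mul (hasFDerivAt_apply (𝕜 := ℝ) (F' := fun _ : Fin n => ℂ) l z)
    simp only [map_mul, eval_X]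
    refine h.congr_fderiv ?_
    ext v
    simp [Derivation.leibniz, pderiv_X, Pi.single_apply, sum_add_distrib, add_mul, mul_sum,
      apply_ite, ite_mul]
    refine sum_congr rfl fun i _ => by ring

theorem contDiff_eval {n : ℕ} (P : MvPolynomial (Fin n) ℂ) :
    ContDiff ℝ ∞ (fun z : Fin n → ℂ => eval z P) := by
  induction P using MvPolynomial.induction_on with
  | C a => simpa using contDiff_const
  | add p q hp hq => simpa using hp.add hq
  | mul_X p l hp => simpa using hp.mul (contDiff_apply ℝ ℂ l)

namespace PhaseSystem

variable {V ι 𝒱 : Type*} [NormedAddCommGroup V] [NormedSpace ℝ V] {n d : ℕ}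
  (Φ : PhaseSystem V ι 𝒱 n d)

/-- The derivative of `P_v` along a word, evaluated at `Λ_v x`. -/
def Q (i : ι) (v : 𝒱) (w : List (Fin n)) (x : V) : ℂ := eval (Φ.Λ v x) (wordDeriv w (Φ.P i v))

/-- The square norm of the derivatives of order `j`. -/
def S (i : ι) (v : 𝒱) (j : ℕ) (x : V) : ℝ := ∑ w : Fin j → Fin n, ‖Φ.Q i v (List.ofFn w) x‖ ^ 2

/-- The power of order `2 d!` of the inverse scale set by the derivatives of order at least `2`. -/
def T (i : ι) (v : 𝒱) (x : V) : ℝ := 1 + ∑ j ∈ Icc 2 d, Φ.S i v j x ^ (d.factorial / j)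

/-- The square norm of the gradient. -/
def G (i : ι) (v : 𝒱) (x : V) : ℝ := ∑ l, ‖Φ.Q i v [l] x‖ ^ 2

/-- The power of order `2 d!` of the inverse scale set by all derivatives. -/
def D (i : ι) (v : 𝒱) (x : V) : ℝ := Φ.T i v x + Φ.G i v x ^ d.factorial

/-- The inverse scale set by the derivatives of order at least `2`. -/
def scale (i : ι) (v : 𝒱) (x : V) : ℝ := Φ.T i v x ^ (((2 * d.factorial : ℕ) : ℝ)⁻¹)

/-- The inverse scale set by all derivatives. -/
def mass (i : ι) (v : 𝒱) (x : V) : ℝ := Φ.D i v x ^ (((2 * d.factorial : ℕ) : ℝ)⁻¹)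

/-- The gain of one integration by parts. -/
def gain (i : ι) (v : 𝒱) (x : V) : ℝ := Φ.scale i v x / Φ.mass i v x

variable (i : ι) (v : 𝒱) (x : V)

theorem S_nonneg (j : ℕ) : 0 ≤ Φ.S i v j x := sum_nonneg fun _ _ => by positivity

theorem G_nonneg : 0 ≤ Φ.G i v x := sum_nonneg fun _ _ => by positivity

theorem one_le_T : 1 ≤ Φ.T i v x :=
  le_add_of_nonneg_right (sum_nonneg fun j _ => pow_nonneg (Φ.S_nonneg i v x j) _)

theorem T_le_D : Φ.T i v x ≤ Φ.D i v x := le_add_of_nonneg_right (pow_nonneg (Φ.G_nonneg i v x) _)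

theorem T_pos : 0 < Φ.T i v x := zero_lt_one.trans_le (Φ.one_le_T i v x)

theorem D_pos : 0 < Φ.D i v x := (Φ.T_pos i v x).trans_le (Φ.T_le_D i v x)

theorem scale_pow : Φ.scale i v x ^ (2 * d.factorial) = Φ.T i v x :=
  Real.rpow_inv_natCast_pow (Φ.T_pos i v x).le (by positivity)

theorem mass_pow : Φ.mass i v x ^ (2 * d.factorial) = Φ.D i v x :=
  Real.rpow_inv_natCast_pow (Φ.D_pos i v x).le (by positivity)

theorem one_le_scale : 1 ≤ Φ.scale i v x := Real.one_le_rpow (Φ.one_le_T i v x) (by positivity)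

theorem scale_pos : 0 < Φ.scale i v x := zero_lt_one.trans_le (Φ.one_le_scale i v x)

theorem scale_le_mass : Φ.scale i v x ≤ Φ.mass i v x :=
  Real.rpow_le_rpow (Φ.T_pos i v x).le (Φ.T_le_D i v x) (by positivity)

theorem mass_pos : 0 < Φ.mass i v x := (Φ.scale_pos i v x).trans_le (Φ.scale_le_mass i v x)

theorem gain_pos : 0 < Φ.gain i v x := div_pos (Φ.scale_pos i v x) (Φ.mass_pos i v x)

theorem gain_le_one : Φ.gain i v x ≤ 1 :=
  (div_le_one (Φ.mass_pos i v x)).2 (Φ.scale_le_mass i v x)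

/-- Every `j ≤ d` divides `d.factorial`, so raising to the power `d.factorial / j` turns the claim
into the bound of `T` below by one of its summands. These integer exponents also make `T` and `D`
polynomial in the derivatives and their conjugates, hence smooth. -/
theorem S_le {j : ℕ} (hj : j ∈ Icc 2 d) : Φ.S i v j x ≤ Φ.scale i v x ^ (2 * j) := by
  have hj' := mem_Icc.1 hj
  have hdvd : j * (d.factorial / j) = d.factorial := Nat.mul_div_cancel' (Nat.dvd_factorial (by omega) hj'.2)
  have hne : d.factorial / j ≠ 0 := fun h => d.factorial_ne_zero (by rw [← hdvd, h, mul_zero])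
  refine (pow_le_pow_iff_left₀ (Φ.S_nonneg i v x j) (pow_nonneg (Φ.scale_pos i v x).le _) hne).1 ?_
  rw [← pow_mul, mul_assoc, hdvd, scale_pow]
  refine le_add_of_nonneg_of_le zero_le_one ?_
  exact single_le_sum (f := fun j => Φ.S i v j x ^ (d.factorial / j))
    (fun j _ => pow_nonneg (Φ.S_nonneg i v x j) _) hj

theorem G_le : Φ.G i v x ≤ Φ.mass i v x ^ 2 := by
  refine (pow_le_pow_iff_left₀ (Φ.G_nonneg i v x) (by positivity) d.factorial_ne_zero).1 ?_
  rw [← pow_mul, mass_pow]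
  exact le_add_of_nonneg_left (Φ.T_pos i v x).le

theorem norm_Q_le {w : List (Fin n)} (hw : 2 ≤ w.length) :
    ‖Φ.Q i v w x‖ ≤ Φ.scale i v x ^ w.length := by
  rcases le_or_gt w.length d with hd | hd
  · refine (pow_le_pow_iff_left₀ (norm_nonneg _) (pow_nonneg (Φ.scale_pos i v x).le _)
      two_ne_zero).1 ?_
    rw [← pow_mul, mul_comm]
    refine le_trans ?_ (Φ.S_le i v x (mem_Icc.2 ⟨hw, hd⟩))
    have := single_le_sum (f := fun u : Fin w.length → Fin n => ‖Φ.Q i v (List.ofFn u) x‖ ^ 2)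
      (fun _ _ => by positivity) (mem_univ w.get)
    simpa [S] using this
  · rw [Q, wordDeriv_eq_zero ((Φ.deg_le i v).trans_lt hd), map_zero, norm_zero]
    exact pow_nonneg (Φ.scale_pos i v x).le _

theorem norm_Q_singleton_le (l : Fin n) : ‖Φ.Q i v [l] x‖ ≤ Φ.mass i v x := by
  refine (pow_le_pow_iff_left₀ (norm_nonneg _) (Φ.mass_pos i v x).le two_ne_zero).1 ?_
  refine le_trans ?_ (Φ.G_le i v x)
  exact single_le_sum (f := fun l => ‖Φ.Q i v [l] x‖ ^ 2) (fun _ _ => by positivity) (mem_univ l)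

theorem contDiff_Q (w : List (Fin n)) : ContDiff ℝ ∞ (Φ.Q i v w) :=
  (contDiff_eval _).comp (Φ.Λ v).contDiff

theorem hasFDerivAt_Q (w : List (Fin n)) : HasFDerivAt (Φ.Q i v w)
    ((∑ l, Φ.Q i v (l :: w) x •
      (ContinuousLinearMap.proj (R := ℝ) (φ := fun _ : Fin n => ℂ) l)).comp (Φ.Λ v)) x :=
  (hasFDerivAt_eval _ _).comp x (Φ.Λ v).hasFDerivAt

theorem fderiv_Q_same (w : List (Fin n)) (l : Fin n) (c : ℂ) :
    fderiv ℝ (Φ.Q i v w) x (Φ.e v l c) = Φ.proj v c * Φ.Q i v (l :: w) x := by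
  rw [(Φ.hasFDerivAt_Q i v x w).fderiv]
  simp [Φ.Λ_e_same, Pi.single_apply, mul_comm]

theorem fderiv_Q_ne {v' : 𝒱} (h : v' ≠ v) (w : List (Fin n)) (l : Fin n) (c : ℂ) :
    fderiv ℝ (Φ.Q i v w) x (Φ.e v' l c) = 0 := by
  rw [(Φ.hasFDerivAt_Q i v x w).fderiv]
  simp [Φ.Λ_e_ne _ _ _ _ h]

/-- The two directions of differentiation for each complex coordinate. -/
def unit (b : Bool) : ℂ := if b then Complex.I else 1

/-- The directions of differentiation. -/
def dir (j : 𝒱 × Fin n × Bool) : V := Φ.e j.1 j.2.1 (unit j.2.2)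

/-- The weight that each differentiation costs. -/
def wt (j : 𝒱 × Fin n × Bool) (i : ι) (x : V) : ℝ := Φ.scale i j.1 x

theorem wt_nonneg (j : 𝒱 × Fin n × Bool) (i : ι) (x : V) : 0 ≤ Φ.wt j i x :=
  (Φ.scale_pos i j.1 x).le

/-- Symbols for the weights of a phase system. -/
abbrev Symbol (w : ι → V → ℝ) (g : ι → V → ℂ) : Prop := IsSymbol Φ.dir Φ.wt w g

/-- A derivative at the same place lengthens the word by one letter, which costs exactly one factor
`scale`; derivatives at other places vanish. -/
theorem symbol_Q {w : List (Fin n)} (hw : 2 ≤ w.length) :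
    Φ.Symbol (fun i x => Φ.scale i v x ^ w.length) (fun i x => Φ.Q i v w x) := by
  classical
  intro N
  have base : ∀ {w : List (Fin n)}, 2 ≤ w.length →
      SymbolBound Φ.dir Φ.wt 0 (fun i x => Φ.scale i v x ^ w.length) (fun i x => Φ.Q i v w x) :=
    fun {w} hw => ⟨fun i => Φ.contDiff_Q i v w, 1, zero_le_one,
      fun i x => by simpa using Φ.norm_Q_le i v x hw⟩
  induction N generalizing w with
  | zero => exact base hw
  | succ N ih =>
    refine ⟨base hw, ?_⟩
    rintro ⟨v', l, b⟩
    rcases eq_or_ne v' v with rfl | h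
    · simp only [dir, fderiv_Q_same]
      have h1 := (symbolBound_const (e := Φ.dir) (h := Φ.wt) N (Φ.proj v' (unit b))).mul Φ.wt_nonneg
        (ih (w := l :: w) (by simp; omega))
      exact h1.mono Φ.wt_nonneg zero_le_one fun i x => by simp [wt, pow_succ]
    · simp only [dir, fderiv_Q_ne _ _ _ _ h]
      exact symbolBound_zero _ _

/-- The gradient itself is only bounded by `mass`, but its derivatives are second derivatives,
bounded by `scale ^ 2 ≤ mass * scale`. -/
theorem symbol_Q_singleton (l : Fin n) :
    Φ.Symbol (fun i x => Φ.mass i v x) (fun i x => Φ.Q i v [l] x) := by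
  classical
  intro N
  have base : SymbolBound Φ.dir Φ.wt 0 (fun i x => Φ.mass i v x) (fun i x => Φ.Q i v [l] x) :=
    ⟨fun i => Φ.contDiff_Q i v [l], 1, zero_le_one,
      fun i x => by simpa using Φ.norm_Q_singleton_le i v x l⟩
  cases N with
  | zero => exact base
  | succ N =>
    refine ⟨base, ?_⟩
    rintro ⟨v', l', b⟩
    rcases eq_or_ne v' v with rfl | h
    · simp only [dir, fderiv_Q_same]
      have h1 := ((Φ.symbol_Q v' (w := [l', l]) (by simp)).const_mul Φ.wt_nonneg
        (Φ.proj v' (unit b))) N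
      refine h1.mono Φ.wt_nonneg zero_le_one fun i x => ?_
      simp only [wt, List.length_cons, List.length_nil, one_mul, zero_add, Nat.reduceAdd, pow_two]
      exact mul_le_mul_of_nonneg_right (Φ.scale_le_mass i v' x) (Φ.scale_pos i v' x).le
    · simp only [dir, fderiv_Q_ne _ _ _ _ h]
      exact symbolBound_zero _ _

theorem ofReal_sq_norm (z : ℂ) : (‖z‖ : ℂ) ^ 2 = z * (starRingEnd ℂ) z :=
  (Complex.mul_conj' z).symm

theorem symbol_T :
    Φ.Symbol (fun i x => Φ.scale i v x ^ (2 * d.factorial)) (fun i x => (Φ.T i v x : ℂ)) := by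
  simp only [T, Complex.ofReal_add, Complex.ofReal_one, Complex.ofReal_sum, Complex.ofReal_pow, S,
    ofReal_sq_norm]
  refine IsSymbol.add ?_ (IsSymbol.sum _ fun j hj => ?_)
  · exact (isSymbol_const 1).of_le Φ.wt_nonneg fun i x => one_le_pow₀ (Φ.one_le_scale i v x)
  · have hj' := mem_Icc.1 hj
    have hdvd : j * (d.factorial / j) = d.factorial := Nat.mul_div_cancel' (Nat.dvd_factorial (by omega) hj'.2)
    have h1 := (IsSymbol.sum univ fun (w : Fin j → Fin n) _ =>
      (Φ.symbol_Q v (w := List.ofFn w) (by simpa using hj'.1)).mul Φ.wt_nonneg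
        (Φ.symbol_Q v (w := List.ofFn w) (by simpa using hj'.1)).conj |>.of_le
          (w₂ := fun i x => Φ.scale i v x ^ (2 * j)) Φ.wt_nonneg fun i x => by
            rw [List.length_ofFn, ← pow_add, two_mul]).pow Φ.wt_nonneg (d.factorial / j)
    refine h1.of_le Φ.wt_nonneg fun i x => ?_
    rw [← pow_mul, mul_assoc, hdvd]

theorem symbol_G : Φ.Symbol (fun i x => Φ.mass i v x ^ 2) (fun i x => (Φ.G i v x : ℂ)) := by
  simp only [G, Complex.ofReal_sum, Complex.ofReal_pow, ofReal_sq_norm]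
  refine IsSymbol.sum _ fun l _ => ?_
  refine ((Φ.symbol_Q_singleton v l).mul Φ.wt_nonneg (Φ.symbol_Q_singleton v l).conj).of_le
    Φ.wt_nonneg fun i x => by rw [pow_two]

theorem symbol_D :
    Φ.Symbol (fun i x => Φ.mass i v x ^ (2 * d.factorial)) (fun i x => (Φ.D i v x : ℂ)) := by
  simp only [D, Complex.ofReal_add, Complex.ofReal_pow]
  refine IsSymbol.add ((Φ.symbol_T v).of_le Φ.wt_nonneg fun i x => ?_)
    (((Φ.symbol_G v).pow Φ.wt_nonneg (d.factorial)).of_le Φ.wt_nonneg fun i x => by rw [← pow_mul])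
  exact pow_le_pow_left₀ (Φ.scale_pos i v x).le (Φ.scale_le_mass i v x) _

theorem symbol_D_inv : Φ.Symbol (fun i x => (Φ.mass i v x ^ (2 * d.factorial))⁻¹)
    (fun i x => ((Φ.D i v x : ℂ))⁻¹) :=
  (Φ.symbol_D v).inv Φ.wt_nonneg zero_lt_one (fun i x => pow_pos (Φ.mass_pos i v x) _)
    fun i x => by
      rw [one_mul, mass_pow, Complex.norm_real, Real.norm_of_nonneg (Φ.D_pos i v x).le]

/-- The component of the gradient of the phase along a direction. -/
def slope (v : 𝒱) (l : Fin n) (b : Bool) (i : ι) (x : V) : ℂ := ((unit b * Φ.Q i v [l] x).re : ℂ)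

theorem symbol_slope (l : Fin n) (b : Bool) :
    Φ.Symbol (fun i x => Φ.mass i v x) (Φ.slope v l b) := by
  have h : Φ.slope v l b = fun i x => (2⁻¹ : ℂ) *
      (unit b * Φ.Q i v [l] x + (starRingEnd ℂ) (unit b * Φ.Q i v [l] x)) := by
    funext i x
    rw [Complex.add_conj, slope]
    push_cast
    ring
  rw [h]
  have h1 := (Φ.symbol_Q_singleton v l).const_mul Φ.wt_nonneg (unit b)
  exact (h1.add h1.conj).const_mul Φ.wt_nonneg _

theorem sum_slope_sq : ∑ l, ∑ b, Φ.slope v l b i x * Φ.slope v l b i x = Φ.G i v x := by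
  simp only [G, Complex.ofReal_sum]
  refine sum_congr rfl fun l _ => ?_
  rw [← Complex.normSq_eq_norm_sq, Complex.normSq_apply]
  simp [slope, unit]
  ring

/-- The coefficient of the differential operator that fixes the oscillating exponential. -/
def coeff (v : 𝒱) (l : Fin n) (b : Bool) (i : ι) (x : V) : ℂ :=
  (Φ.G i v x : ℂ) ^ (d.factorial - 1) * Φ.slope v l b i x * ((Φ.D i v x : ℂ))⁻¹

/-- The powers of `mass` balance as `2 (d! - 1) + 1 - 2 d! = -1`. -/
theorem symbol_coeff (l : Fin n) (b : Bool) :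
    Φ.Symbol (fun i x => (Φ.mass i v x)⁻¹) (Φ.coeff v l b) := by
  refine ((((Φ.symbol_G v).pow Φ.wt_nonneg (d.factorial - 1)).mul Φ.wt_nonneg
    (Φ.symbol_slope v l b)).mul Φ.wt_nonneg (Φ.symbol_D_inv v)).of_le Φ.wt_nonneg fun i x => ?_
  have hm := Φ.mass_pos i v x
  obtain ⟨M, hM⟩ : ∃ M, d.factorial = M + 1 := ⟨d.factorial - 1, by have := d.factorial_pos; omega⟩
  rw [hM, Nat.add_sub_cancel, ← pow_mul, ← pow_succ, show 2 * (M + 1) = 2 * M + 1 + 1 by ring,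
    pow_succ _ (2 * M + 1), mul_inv, ← mul_assoc, mul_inv_cancel₀ (pow_pos hm _).ne', one_mul]

/-- The squares of the slopes add up to `G`, so the double sum is `G ^ d! / D`, and `D = T + G ^
d!`. The term `T / D` keeps the partition of unity valid at critical points, where there is nothing
to integrate by parts. -/
theorem sum_coeff_mul_slope :
    (Φ.T i v x : ℂ) * ((Φ.D i v x : ℂ))⁻¹ + ∑ l, ∑ b, Φ.coeff v l b i x * Φ.slope v l b i x = 1 := by
  have h : ∀ l b, Φ.coeff v l b i x * Φ.slope v l b i x =
      (Φ.G i v x : ℂ) ^ (d.factorial - 1) * ((Φ.D i v x : ℂ))⁻¹ *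
        (Φ.slope v l b i x * Φ.slope v l b i x) := by
    intro l b
    rw [coeff]
    ring
  simp only [h, ← mul_sum, sum_slope_sq]
  have hD : (Φ.D i v x : ℂ) ≠ 0 := Complex.ofReal_ne_zero.2 (Φ.D_pos i v x).ne'
  have hp : (Φ.G i v x : ℂ) ^ (d.factorial - 1) * Φ.G i v x = (Φ.G i v x : ℂ) ^ d.factorial := by
    rw [← pow_succ, Nat.sub_add_cancel d.factorial_pos]
  rw [mul_right_comm, hp, ← add_mul, ← div_eq_mul_inv, div_eq_one_iff_eq hD]
  simp [D]

end PhaseSystem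

end PhaseSystem


/-! ### Integration by parts against the phase. -/

namespace PhaseSystem

open MvPolynomial Finset MeasureTheory

variable {V ι 𝒱 : Type*} [NormedAddCommGroup V] [NormedSpace ℝ V] {n d : ℕ}
  (Φ : PhaseSystem V ι 𝒱 n d)

theorem continuous_T (i : ι) (v : 𝒱) : Continuous (Φ.T i v) := by
  simpa [Function.comp_def] using Complex.continuous_re.comp ((Φ.symbol_T v).contDiff i).continuous

theorem continuous_D (i : ι) (v : 𝒱) : Continuous (Φ.D i v) := by
  simpa [Function.comp_def] using Complex.continuous_re.comp ((Φ.symbol_D v).contDiff i).continuous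

theorem continuous_scale (i : ι) (v : 𝒱) : Continuous (Φ.scale i v) :=
  (Φ.continuous_T i v).rpow_const fun x => Or.inl (Φ.T_pos i v x).ne'

theorem continuous_mass (i : ι) (v : 𝒱) : Continuous (Φ.mass i v) :=
  (Φ.continuous_D i v).rpow_const fun x => Or.inl (Φ.D_pos i v x).ne'

theorem continuous_gain (i : ι) (v : 𝒱) : Continuous (Φ.gain i v) :=
  (Φ.continuous_scale i v).div (Φ.continuous_mass i v) fun x => (Φ.mass_pos i v x).ne'

variable [Fintype 𝒱]

/-- The phase function. -/
def phase (i : ι) (x : V) : ℝ := ∑ v, Φ.μ v * (eval (Φ.Λ v x) (Φ.P i v)).re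

/-- The oscillating exponential. -/
def osc (i : ι) (x : V) : ℂ := Complex.exp (2 * Real.pi * Complex.I * (Φ.phase i x : ℂ))

theorem contDiff_phase (i : ι) : ContDiff ℝ ∞ (Φ.phase i) :=
  ContDiff.sum fun v _ => contDiff_const.mul
    (Complex.reCLM.contDiff.comp (Φ.contDiff_Q i v []))

theorem contDiff_osc (i : ι) : ContDiff ℝ ∞ (Φ.osc i) :=
  (contDiff_const.mul (Complex.ofRealCLM.contDiff.comp (Φ.contDiff_phase i))).cexp

theorem norm_osc (i : ι) (x : V) : ‖Φ.osc i x‖ = 1 := by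
  have : (2 * Real.pi * Complex.I * (Φ.phase i x : ℂ)) =
      ((2 * Real.pi * Φ.phase i x : ℝ) : ℂ) * Complex.I := by push_cast; ring
  rw [osc, this, Complex.norm_exp_ofReal_mul_I]

theorem fderiv_phase (i : ι) (x : V) (v : 𝒱) (l : Fin n) (c : ℂ) :
    fderiv ℝ (Φ.phase i) x (Φ.e v l c) = Φ.μ v * (c * Φ.Q i v [l] x).re := by
  classical
  have h : HasFDerivAt (Φ.phase i)
      (∑ v, Φ.μ v • Complex.reCLM.comp (fderiv ℝ (Φ.Q i v []) x)) x := by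
    refine HasFDerivAt.fun_sum fun v _ => HasFDerivAt.const_mul ?_ _
    exact Complex.reCLM.hasFDerivAt.comp x
      (((Φ.contDiff_Q i v []).differentiable (by simp)) x).hasFDerivAt
  rw [h.fderiv]
  simp only [_root_.sum_apply, _root_.smul_apply, ContinuousLinearMap.comp_apply]
  rw [sum_eq_single v _ (by simp), fderiv_Q_same]
  · have := Φ.re_proj_mul i v l c x
    simp only [Complex.reCLM_apply, smul_eq_mul]
    congr 1
  · intro v' _ hv'
    rw [Φ.fderiv_Q_ne _ _ _ hv'.symm]
    simp

theorem fderiv_osc (i : ι) (x : V) (v : 𝒱) (l : Fin n) (b : Bool) :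
    fderiv ℝ (Φ.osc i) x (Φ.dir (v, l, b)) =
      (2 * Real.pi * Complex.I * Φ.μ v) * (Φ.slope v l b i x * Φ.osc i x) := by
  have h1 : HasFDerivAt (Φ.phase i) (fderiv ℝ (Φ.phase i) x) x :=
    ((Φ.contDiff_phase i).differentiable (by simp) x).hasFDerivAt
  have h2 := ((Complex.ofRealCLM.hasFDerivAt.comp x h1).const_mul
    (2 * Real.pi * Complex.I)).cexp
  have h3 : fderiv ℝ (Φ.osc i) x = _ := h2.fderiv
  rw [h3]
  simp only [_root_.smul_apply, ContinuousLinearMap.comp_apply, dir, fderiv_phase,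
    Function.comp_apply, smul_eq_mul, Complex.ofRealCLM_apply, Complex.ofReal_mul, slope, osc]
  ring

variable [FiniteDimensional ℝ V] [MeasurableSpace V] [BorelSpace V] (ν : Measure V)
  [ν.IsAddHaarMeasure]

theorem integral_osc_mul_fderiv (i : ι) (v : 𝒱) (l : Fin n) (b : Bool) {g : V → ℂ}
    (hg : ContDiff ℝ ∞ g) (hc : HasCompactSupport g) :
    ∫ x, Φ.osc i x * fderiv ℝ g x (Φ.dir (v, l, b)) ∂ν =
      -((2 * Real.pi * Complex.I * Φ.μ v) * ∫ x, Φ.osc i x * (Φ.slope v l b i x * g x) ∂ν) := by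
  have hosc := (Φ.contDiff_osc i).continuous
  have hosc' : Continuous fun x => fderiv ℝ (Φ.osc i) x (Φ.dir (v, l, b)) :=
    (((Φ.contDiff_osc i).fderiv_right (m := ∞) (by simp)).clm_apply contDiff_const).continuous
  have hg' : Continuous fun x => fderiv ℝ g x (Φ.dir (v, l, b)) :=
    ((hg.fderiv_right (m := ∞) (by simp)).clm_apply contDiff_const).continuous
  have hint : ∀ {f k : V → ℂ}, Continuous f → Continuous k → HasCompactSupport k →
      Integrable (fun x => f x * k x) ν := fun hf hk hck =>
    (hf.mul hk).integrable_of_hasCompactSupport hck.mul_left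
  rw [integral_mul_fderiv_eq_neg_fderiv_mul_of_integrable
    (hint hosc' hg.continuous hc) (hint hosc hg' (hc.fderiv_apply ℝ _)) (hint hosc hg.continuous hc)
    (fun x _ => (Φ.contDiff_osc i).differentiable (by simp) x)
    (fun x _ => hg.differentiable (by simp) x), ← integral_const_mul]
  congr 2
  funext x
  rw [fderiv_osc]
  ring

/-- Split `g` by the partition of unity `sum_coeff_mul_slope`. The term with `T / D` is already
small, and in the others a slope times the exponential is a derivative of the exponential, which is
moved onto the amplitude. -/
theorem exists_gain_step {w : ι → V → ℝ} {g : ι → V → ℂ} (hw : ∀ i x, 0 ≤ w i x)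
    (hg : Φ.Symbol w g) (hc : ∀ i, HasCompactSupport (g i)) (v : 𝒱) :
    ∃ g' : ι → V → ℂ, Φ.Symbol (fun i x => w i x * Φ.gain i v x) g' ∧
      (∀ i, tsupport (g' i) ⊆ tsupport (g i)) ∧
      ∀ i, ∫ x, Φ.osc i x * g' i x ∂ν = ∫ x, Φ.osc i x * g i x ∂ν := by
  have hμ : (2 * Real.pi * Complex.I * Φ.μ v) ≠ 0 := by
    simp [Φ.μ_ne v, Real.pi_ne_zero]
  have sc : ∀ l b, Φ.Symbol (fun i x => (Φ.mass i v x)⁻¹ * w i x)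
      (fun i x => Φ.coeff v l b i x * g i x) := fun l b =>
    (Φ.symbol_coeff v l b).mul Φ.wt_nonneg hg
  have cc : ∀ l b i, HasCompactSupport fun x => Φ.coeff v l b i x * g i x := fun l b i =>
    (hc i).mul_left
  refine ⟨fun i x => (Φ.T i v x : ℂ) * ((Φ.D i v x : ℂ))⁻¹ * g i x +
    ∑ l, ∑ b, -(2 * Real.pi * Complex.I * Φ.μ v)⁻¹ *
      fderiv ℝ (fun x => Φ.coeff v l b i x * g i x) x (Φ.dir (v, l, b)), ?_, ?_, ?_⟩
  · refine IsSymbol.add ?_ (IsSymbol.sum _ fun l _ => IsSymbol.sum _ fun b _ =>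
      IsSymbol.const_mul Φ.wt_nonneg _ ?_)
    · refine ((((Φ.symbol_T v).mul Φ.wt_nonneg (Φ.symbol_D_inv v)).mul Φ.wt_nonneg hg)).of_le
        Φ.wt_nonneg fun i x => ?_
      -- `T / D` has weight `gain ^ (2 * d!)`, which is at most `gain` since the gain is at most
      -- `1`.
      rw [mul_comm (w i x), ← div_eq_mul_inv, ← div_pow]
      exact mul_le_mul_of_nonneg_right (pow_le_of_le_one (Φ.gain_pos i v x).le
        (Φ.gain_le_one i v x) (by positivity)) (hw i x)
    -- The coefficient brings in `1 / mass` and the derivative costs `scale`.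
    · refine ((sc l b).deriv (v, l, b)).of_le Φ.wt_nonneg fun i x => le_of_eq ?_
      rw [gain, wt]
      ring
  · intro i
    refine closure_minimal (fun x hx => ?_) (isClosed_tsupport _)
    contrapose! hx
    have h1 : g i x = 0 := image_eq_zero_of_notMem_tsupport hx
    have h2 : ∀ l b, fderiv ℝ (fun x => Φ.coeff v l b i x * g i x) x = 0 := fun l b => by
      refine image_eq_zero_of_notMem_tsupport fun hx' => hx ?_
      exact tsupport_mul_subset_right (tsupport_fderiv_subset ℝ hx')
    simp [h1, h2]
  · intro i
    have hosc := (Φ.contDiff_osc i).continuous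
    have hgc := (hg.contDiff i).continuous
    have hslope : ∀ l b, Continuous (Φ.slope v l b i) := fun l b =>
      ((Φ.symbol_slope v l b).contDiff i).continuous
    have hcoeff : ∀ l b, Continuous (Φ.coeff v l b i) := fun l b =>
      ((Φ.symbol_coeff v l b).contDiff i).continuous
    have hTD : Continuous fun x => (Φ.T i v x : ℂ) * ((Φ.D i v x : ℂ))⁻¹ :=
      (((Φ.symbol_T v).mul Φ.wt_nonneg (Φ.symbol_D_inv v)).contDiff i).continuous
    have hint : ∀ {f k : V → ℂ}, Continuous f → Continuous k → HasCompactSupport k →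
        Integrable (fun x => f x * k x) ν := fun hf hk hck =>
      (hf.mul hk).integrable_of_hasCompactSupport hck.mul_left
    have i1 : Integrable (fun x => Φ.osc i x * ((Φ.T i v x : ℂ) * ((Φ.D i v x : ℂ))⁻¹ * g i x)) ν :=
      hint hosc (hTD.mul hgc) (hc i).mul_left
    have i2 : ∀ l b, Integrable (fun x => Φ.osc i x * (-(2 * Real.pi * Complex.I * Φ.μ v)⁻¹ *
        fderiv ℝ (fun x => Φ.coeff v l b i x * g i x) x (Φ.dir (v, l, b)))) ν := fun l b =>
      hint hosc (continuous_const.mul (((sc l b).deriv (v, l, b)).contDiff i).continuous)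
        ((cc l b i).fderiv_apply ℝ _).mul_left
    have i3 : ∀ l b, Integrable (fun x => Φ.osc i x *
        (Φ.slope v l b i x * (Φ.coeff v l b i x * g i x))) ν := fun l b =>
      hint hosc ((hslope l b).mul ((hcoeff l b).mul hgc)) (cc l b i).mul_left
    have e : ∀ l b, ∫ x, Φ.osc i x * (-(2 * Real.pi * Complex.I * Φ.μ v)⁻¹ *
        fderiv ℝ (fun x => Φ.coeff v l b i x * g i x) x (Φ.dir (v, l, b))) ∂ν =
        ∫ x, Φ.osc i x * (Φ.slope v l b i x * (Φ.coeff v l b i x * g i x)) ∂ν := by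
      intro l b
      have h := Φ.integral_osc_mul_fderiv ν i v l b ((sc l b).contDiff i) (cc l b i)
      simp only [mul_left_comm (Φ.osc i _) (-_ : ℂ)]
      rw [integral_const_mul, h, neg_mul_neg, inv_mul_cancel_left₀ hμ]
    simp only [mul_add, mul_sum]
    rw [integral_add i1 (integrable_finsetSum _ fun l _ => integrable_finsetSum _ fun b _ => i2 l b),
      integral_finsetSum _ fun l _ => integrable_finsetSum _ fun b _ => i2 l b]
    have e' : ∀ l, ∫ x, ∑ b, Φ.osc i x * (-(2 * Real.pi * Complex.I * Φ.μ v)⁻¹ *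
        fderiv ℝ (fun x => Φ.coeff v l b i x * g i x) x (Φ.dir (v, l, b))) ∂ν =
        ∫ x, ∑ b, Φ.osc i x * (Φ.slope v l b i x * (Φ.coeff v l b i x * g i x)) ∂ν := by
      intro l
      rw [integral_finsetSum _ fun b _ => i2 l b, integral_finsetSum _ fun b _ => i3 l b]
      exact sum_congr rfl fun b _ => e l b
    simp only [e']
    rw [← integral_finsetSum _ fun l _ => integrable_finsetSum _ fun b _ => i3 l b, ← integral_add
      i1 (integrable_finsetSum _ fun l _ => integrable_finsetSum _ fun b _ => i3 l b)]
    congr 1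
    funext x
    have h := Φ.sum_coeff_mul_slope i v x
    calc _ = Φ.osc i x * (((Φ.T i v x : ℂ) * ((Φ.D i v x : ℂ))⁻¹ +
          ∑ l, ∑ b, Φ.coeff v l b i x * Φ.slope v l b i x) * g i x) := by
          rw [add_mul, mul_add, sum_mul, mul_sum]
          simp only [sum_mul, mul_sum]
          congr 1
          refine sum_congr rfl fun l _ => sum_congr rfl fun b _ => by ring
      _ = _ := by rw [h, one_mul]

/-- Repeated integration by parts: the oscillatory integral is bounded by the integral of any
product of powers of the gains. -/
theorem exists_norm_integral_osc_le {ψ : V → ℂ} (hψ : ContDiff ℝ ∞ ψ) (hc : HasCompactSupport ψ)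
    (N : ℕ) (A : Finset 𝒱) : ∃ C : ℝ, 0 ≤ C ∧ ∀ i,
      ENNReal.ofReal ‖∫ x, Φ.osc i x * ψ x ∂ν‖ ≤
        ENNReal.ofReal C * ∫⁻ x in tsupport ψ, ∏ v ∈ A, ENNReal.ofReal (Φ.gain i v x ^ N) ∂ν := by
  classical
  have pow : ∀ (v : 𝒱) (N : ℕ) {w : ι → V → ℝ} {g : ι → V → ℂ}, (∀ i x, 0 ≤ w i x) →
      Φ.Symbol w g → (∀ i, HasCompactSupport (g i)) →
      ∃ g' : ι → V → ℂ, Φ.Symbol (fun i x => w i x * Φ.gain i v x ^ N) g' ∧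
      (∀ i, tsupport (g' i) ⊆ tsupport (g i)) ∧
      ∀ i, ∫ x, Φ.osc i x * g' i x ∂ν = ∫ x, Φ.osc i x * g i x ∂ν := by
    intro v N
    induction N with
    | zero => exact fun {w g} hw hg hc => ⟨g, by simpa using hg, fun i => subset_rfl, fun i => rfl⟩
    | succ N ih =>
      intro w g hw hg hc
      obtain ⟨g₁, h₁, s₁, e₁⟩ := ih hw hg hc
      obtain ⟨g₂, h₂, s₂, e₂⟩ := Φ.exists_gain_step ν
        (fun i x => mul_nonneg (hw i x) (pow_nonneg (Φ.gain_pos i v x).le N)) h₁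
        (fun i => (hc i).of_isClosed_subset (isClosed_tsupport _) (s₁ i)) v
      exact ⟨g₂, h₂.of_le Φ.wt_nonneg fun i x => le_of_eq (by ring),
        fun i => (s₂ i).trans (s₁ i), fun i => (e₂ i).trans (e₁ i)⟩
  have prod : ∃ g' : ι → V → ℂ, Φ.Symbol (fun i x => ∏ v ∈ A, Φ.gain i v x ^ N) g' ∧
      (∀ i, tsupport (g' i) ⊆ tsupport ψ) ∧
      ∀ i, ∫ x, Φ.osc i x * g' i x ∂ν = ∫ x, Φ.osc i x * ψ x ∂ν := by
    induction A using Finset.induction_on with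
    | empty =>
      -- The summand `1` in `T` ensures that every differentiation weight is at least `1`, so `ψ` is
      -- a symbol of weight `1`.
      have h := isSymbol_of_hasCompactSupport (e := Φ.dir) (h := Φ.wt)
        (fun j i x => Φ.one_le_scale i j.1 x) hψ hc
      exact ⟨fun _ => ψ, by simpa using h, fun i => subset_rfl, fun i => rfl⟩
    | insert v A hv ih =>
      obtain ⟨g₁, h₁, s₁, e₁⟩ := ih
      obtain ⟨g₂, h₂, s₂, e₂⟩ := pow v N
        (fun i x => prod_nonneg fun v _ => pow_nonneg (Φ.gain_pos i v x).le N) h₁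
        (fun i => hc.of_isClosed_subset (isClosed_tsupport _) (s₁ i))
      exact ⟨g₂, h₂.of_le Φ.wt_nonneg fun i x => le_of_eq (by rw [prod_insert hv, mul_comm]),
        fun i => (s₂ i).trans (s₁ i), fun i => (e₂ i).trans (e₁ i)⟩
  obtain ⟨g', h', s', e'⟩ := prod
  obtain ⟨C, hC, hb⟩ := h'.bound
  refine ⟨C, hC, fun i => ?_⟩
  rw [← e' i, ofReal_norm]
  refine (enorm_integral_le_lintegral_enorm _).trans ?_
  rw [← lintegral_const_mul' _ _ ENNReal.ofReal_ne_top,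
    ← lintegral_indicator (isClosed_tsupport ψ).measurableSet]
  refine lintegral_mono fun x => ?_
  by_cases hx : x ∈ tsupport ψ
  · rw [Set.indicator_of_mem hx, ← ofReal_norm, norm_mul, norm_osc, one_mul,
      ← ENNReal.ofReal_prod_of_nonneg fun v _ => pow_nonneg (Φ.gain_pos i v x).le N,
      ← ENNReal.ofReal_mul hC]
    exact ENNReal.ofReal_le_ofReal (hb i x)
  · rw [Set.indicator_of_notMem hx, image_eq_zero_of_notMem_tsupport fun h => hx (s' i h)]
    simp

end PhaseSystem


/-! ### Integrals of decaying bumps. -/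

section Decay

open MeasureTheory Module

variable {F : Type*} [NormedAddCommGroup F] [NormedSpace ℝ F] [FiniteDimensional ℝ F]
  [MeasurableSpace F] [BorelSpace F]

/-- The integral of a decaying bump of width `1 / H` is `O(H⁻ᵐ)` in dimension `m`. -/
theorem exists_lintegral_decay_le (ν : Measure F) [ν.IsAddHaarMeasure] : ∃ C : ℝ≥0,
    ∀ H : ℝ, 0 < H → ∀ a : F,
      ∫⁻ t, ENNReal.ofReal (((1 + H * ‖t - a‖) ^ (finrank ℝ F + 1))⁻¹) ∂ν ≤
        C * ENNReal.ofReal ((H ^ finrank ℝ F)⁻¹) := by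
  -- The exponent exceeds the dimension by one, so the unit bump is integrable; the general case
  -- follows by translation and dilation.
  have hfin : ∫⁻ t : F, ENNReal.ofReal (((1 + ‖t‖) ^ (finrank ℝ F + 1))⁻¹) ∂ν < ⊤ := by
    have h := finite_integral_one_add_norm (E := F) (μ := ν) (r := ((finrank ℝ F + 1 : ℕ) : ℝ))
      (by push_cast; linarith)
    refine lt_of_eq_of_lt (lintegral_congr fun t => ?_) h
    rw [Real.rpow_neg (by positivity), Real.rpow_natCast]
  refine ⟨(∫⁻ t : F, ENNReal.ofReal (((1 + ‖t‖) ^ (finrank ℝ F + 1))⁻¹) ∂ν).toNNReal,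
    fun H hH a => le_of_eq ?_⟩
  rw [ENNReal.coe_toNNReal hfin.ne,
    lintegral_sub_right_eq_self (μ := ν)
      (fun t => ENNReal.ofReal (((1 + H * ‖t‖) ^ (finrank ℝ F + 1))⁻¹)) a]
  have h1 : ∀ t : F, ENNReal.ofReal (((1 + H * ‖t‖) ^ (finrank ℝ F + 1))⁻¹) =
      (fun u : F => ENNReal.ofReal (((1 + ‖u‖) ^ (finrank ℝ F + 1))⁻¹)) (H • t) := by
    intro t
    simp [norm_smul, abs_of_pos hH]
  simp only [h1]
  have hmeas : Measurable fun u : F => ENNReal.ofReal (((1 + ‖u‖) ^ (finrank ℝ F + 1))⁻¹) := by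
    fun_prop
  rw [← lintegral_map hmeas (measurable_const_smul H), Measure.map_addHaar_smul ν hH.ne',
    lintegral_smul_measure, smul_eq_mul, mul_comm, abs_of_pos (by positivity)]

end Decay

/-! ### The gain near critical points on a line. -/

namespace PhaseSystem

open MvPolynomial Finset MeasureTheory Module

variable {V ι 𝒱 : Type*} [NormedAddCommGroup V] [NormedSpace ℝ V] {n d : ℕ}
  (Φ : PhaseSystem V ι 𝒱 n d)

theorem Q_add_e (i : ι) {v v' : 𝒱} (h : v ≠ v') (w : List (Fin n)) (x : V) (l : Fin n) (c : ℂ) :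
    Φ.Q i v' w (x + Φ.e v l c) = Φ.Q i v' w x := by
  rw [Q, map_add, Φ.Λ_e_ne _ _ _ _ h, add_zero, Q]

theorem scale_add_e (i : ι) {v v' : 𝒱} (h : v ≠ v') (x : V) (l : Fin n) (c : ℂ) :
    Φ.scale i v' (x + Φ.e v l c) = Φ.scale i v' x := by
  simp only [scale, T, S, Φ.Q_add_e i h]

theorem mass_add_e (i : ι) {v v' : 𝒱} (h : v ≠ v') (x : V) (l : Fin n) (c : ℂ) :
    Φ.mass i v' (x + Φ.e v l c) = Φ.mass i v' x := by
  simp only [mass, D, T, S, G, Φ.Q_add_e i h]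

/-- The sixth power of the gain, restricted to the set where the inverse scale is at least `H`. -/
def cut (i : ι) (v : 𝒱) (H : ℝ) : V → ℝ≥0∞ :=
  {x | H ≤ Φ.mass i v x}.indicator fun x => ENNReal.ofReal (Φ.gain i v x ^ 6)

theorem cut_add_e (i : ι) {v v' : 𝒱} (h : v ≠ v') (H : ℝ) (x : V) (l : Fin n) (c : ℂ) :
    Φ.cut i v' H (x + Φ.e v l c) = Φ.cut i v' H x := by
  simp only [cut, Set.indicator, Set.mem_ofPred_eq, gain, Φ.mass_add_e i h, Φ.scale_add_e i h]

theorem measurable_cut [MeasurableSpace V] [BorelSpace V] (i : ι) (v : 𝒱) (H : ℝ) :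
    Measurable (Φ.cut i v H) :=
  ((Φ.continuous_gain i v).pow 6).measurable.ennreal_ofReal.indicator
    (isClosed_le continuous_const (Φ.continuous_mass i v)).measurableSet

/-- The parameters of the directions along which derivatives of order `2, …, d` are compared. -/
abbrev LineIndex (n d : ℕ) := (j : Fin (d + 1)) × (Fin j → Fin n) × Finset (Fin j)

/-- The direction attached to a parameter. -/
def lineDir (a : LineIndex n d) : Fin n → ℂ := ∑ s ∈ a.2.2, Pi.single (a.2.1 s) 1

/-- The derivative of order `j` of `P_v` along a direction, evaluated at `Λ_v x`. -/
def lineDeriv (i : ι) (v : 𝒱) (a : LineIndex n d) (x : V) : ℂ :=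
  eval (Φ.Λ v x) ((dirDeriv (lineDir a))^[a.1] (Φ.P i v))

/-- The comparison constant between the scale and the best directional derivative. -/
def lineConst (n d : ℕ) : ℝ := (d + 1) * (n + 1) ^ d * 4 ^ d

theorem one_le_lineConst (n d : ℕ) : 1 ≤ lineConst n d := by
  have h1 : (1 : ℝ) ≤ (d + 1 : ℝ) := by simp
  have h2 : (1 : ℝ) ≤ (n + 1 : ℝ) ^ d := one_le_pow₀ (by simp)
  have h3 : (1 : ℝ) ≤ (4 : ℝ) ^ d := one_le_pow₀ (by norm_num)
  exact one_le_mul_of_one_le_of_one_le (one_le_mul_of_one_le_of_one_le h1 h2) h3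

/-- The set where a directional derivative realizes the scale. -/
def lineSet (i : ι) (v : 𝒱) (a : LineIndex n d) : Set V :=
  {x | 2 ≤ (a.1 : ℕ) ∧ Φ.scale i v x ^ (a.1 : ℕ) ≤ lineConst n d * ‖Φ.lineDeriv i v a x‖}

/-- Pigeonhole: `T` is `1` plus at most `d` summands, so when `T > d + 1` they cannot all be at most
`T / (d + 1)`. -/
theorem exists_scale_pow_le_S (i : ι) (v : 𝒱) (x : V) (hT : (d + 1 : ℝ) < Φ.T i v x) :
    ∃ j ∈ Icc 2 d, Φ.scale i v x ^ (2 * j) ≤ (d + 1) * Φ.S i v j x := by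
  by_contra! hcon
  have hd : (0 : ℝ) < d + 1 := by positivity
  have hle : ∀ j ∈ Icc 2 d, Φ.S i v j x ^ (d.factorial / j) ≤ Φ.T i v x / (d + 1) := by
    intro j hj
    have hj' := mem_Icc.1 hj
    have hdvd : j * (d.factorial / j) = d.factorial :=
      Nat.mul_div_cancel' (Nat.dvd_factorial (by omega) hj'.2)
    have hne : d.factorial / j ≠ 0 := fun h => d.factorial_ne_zero (by rw [← hdvd, h, mul_zero])
    rw [le_div_iff₀ hd]
    calc Φ.S i v j x ^ (d.factorial / j) * (d + 1)
        ≤ Φ.S i v j x ^ (d.factorial / j) * (d + 1) ^ (d.factorial / j) := by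
          have := pow_nonneg (Φ.S_nonneg i v x j) (d.factorial / j)
          gcongr
          exact le_self_pow₀ (by simp) hne
      _ = ((d + 1) * Φ.S i v j x) ^ (d.factorial / j) := by rw [← mul_pow, mul_comm]
      _ ≤ (Φ.scale i v x ^ (2 * j)) ^ (d.factorial / j) :=
          pow_le_pow_left₀ (mul_nonneg hd.le (Φ.S_nonneg i v x j)) (hcon j hj).le _
      _ = Φ.T i v x := by rw [← pow_mul, mul_assoc, hdvd, scale_pow]
  have hs := sum_le_sum hle
  rw [sum_const, Nat.card_Icc, nsmul_eq_mul] at hs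
  have hTe : Φ.T i v x = 1 + ∑ j ∈ Icc 2 d, Φ.S i v j x ^ (d.factorial / j) := rfl
  have hc : ((d + 1 - 2 : ℕ) : ℝ) ≤ d := by exact_mod_cast (by omega : d + 1 - 2 ≤ d)
  have hq : 1 < Φ.T i v x / (d + 1) := (one_lt_div hd).2 hT
  have h1 : ((d + 1 - 2 : ℕ) : ℝ) * (Φ.T i v x / (d + 1)) ≤ d * (Φ.T i v x / (d + 1)) := by
    gcongr
  have h2 : (d + 1 : ℝ) * (Φ.T i v x / (d + 1)) = Φ.T i v x := by field_simp
  linarith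

/-- Either the scale is bounded and the gain is small outright, or some order `j ≥ 2` dominates `T`.
In the second case the largest mixed derivative of that order is dominated by a pure one through
polarization. -/
theorem gain_le_or_mem_lineSet (i : ι) (v : 𝒱) (x : V) {H : ℝ} (hH : 0 < H)
    (hx : H ≤ Φ.mass i v x) :
    Φ.gain i v x ≤ (d + 1) / H ∨ ∃ a : LineIndex n d, x ∈ Φ.lineSet i v a := by
  rcases le_or_gt (Φ.T i v x) (d + 1) with hT | hT
  · left
    have h1 : Φ.scale i v x ≤ d + 1 := by
      refine (pow_le_pow_iff_left₀ (Φ.scale_pos i v x).le (by positivity)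
        (n := 2 * d.factorial) (by positivity)).1 ?_
      rw [scale_pow]
      exact hT.trans (le_self_pow₀ (by simp) (by positivity))
    exact div_le_div₀ (by positivity) h1 hH hx
  · right
    obtain ⟨j, hj, hjS⟩ := Φ.exists_scale_pow_le_S i v x hT
    have hj' := mem_Icc.1 hj
    -- For `n = 0` there are no words of length `j`, so `S` would vanish although it dominates a
    -- positive scale.
    have hne : (univ : Finset (Fin j → Fin n)).Nonempty := by
      by_contra h
      rw [not_nonempty_iff_eq_empty] at h
      rw [S, h, sum_empty, mul_zero] at hjS
      exact absurd hjS (not_le.2 (pow_pos (Φ.scale_pos i v x) _))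
    obtain ⟨w, -, hw⟩ := exists_max_image univ
      (fun w : Fin j → Fin n => ‖Φ.Q i v (List.ofFn w) x‖ ^ 2) hne
    have hS : Φ.S i v j x ≤ (n : ℝ) ^ j * ‖Φ.Q i v (List.ofFn w) x‖ ^ 2 := by
      refine (sum_le_card_nsmul _ _ _ fun u hu => hw u hu).trans_eq ?_
      simp
    obtain ⟨A, hA⟩ := exists_norm_wordDeriv_le w (Φ.P i v) (Φ.Λ v x)
    refine ⟨⟨⟨j, by omega⟩, w, A⟩, hj'.1, ?_⟩
    set B := ‖Φ.lineDeriv i v ⟨⟨j, by omega⟩, w, A⟩ x‖ with hB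
    have hB0 : 0 ≤ B := norm_nonneg _
    change ‖Φ.Q i v (List.ofFn w) x‖ ≤ 2 ^ j * B at hA
    change Φ.scale i v x ^ j ≤ lineConst n d * B
    refine (pow_le_pow_iff_left₀ (pow_nonneg (Φ.scale_pos i v x).le _)
      (mul_nonneg (zero_le_one.trans (one_le_lineConst n d)) hB0) two_ne_zero).1 ?_
    have hn : (n : ℝ) ^ j ≤ (n + 1) ^ d :=
      (pow_le_pow_left₀ (by positivity) (by simp) j).trans (pow_le_pow_right₀ (by simp) hj'.2)
    have h4 : (4 : ℝ) ^ j ≤ 4 ^ d := pow_le_pow_right₀ (by norm_num) hj'.2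
    -- The factors of `lineConst` come from the pigeonhole, the number of words, and the squared
    -- polarization loss `2 ^ j`.
    calc (Φ.scale i v x ^ j) ^ 2 = Φ.scale i v x ^ (2 * j) := by rw [← pow_mul, mul_comm]
      _ ≤ (d + 1) * ((n : ℝ) ^ j * ‖Φ.Q i v (List.ofFn w) x‖ ^ 2) := by
          refine hjS.trans ?_
          gcongr
      _ ≤ (d + 1) * ((n + 1) ^ d * (2 ^ j * B) ^ 2) := by gcongr
      _ = (d + 1) * (n + 1) ^ d * 4 ^ j * B ^ 2 := by
          rw [mul_pow, ← pow_mul, mul_comm j 2, pow_mul]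
          norm_num
          ring
      _ ≤ lineConst n d * B ^ 2 := by
          rw [lineConst]
          gcongr
      _ ≤ lineConst n d ^ 2 * B ^ 2 := by
          gcongr
          exact le_self_pow₀ (one_le_lineConst n d) two_ne_zero
      _ = _ := by rw [mul_pow]

/-- The comparison constant between the gain and the distance to critical points on a line. -/
def rootConst (n d : ℕ) : ℝ := lineConst n d * (d + 1) ^ (d + 1)

theorem one_le_rootConst (n d : ℕ) : 1 ≤ rootConst n d :=
  one_le_mul_of_one_le_of_one_le (one_le_lineConst n d) (one_le_pow₀ (by simp))

/-- On a line along which a directional derivative realizes the scale, the gain is controlled by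
the distance to the critical points of the restricted polynomial. -/
theorem exists_root_gain_sq_le (i : ι) (v : 𝒱) (a : LineIndex n d) (x x' : V) (t : ℂ)
    (hx' : Φ.Λ v x' = fun l => Φ.Λ v x l + t * lineDir a l) (ha : x' ∈ Φ.lineSet i v a) {H : ℝ}
    (hH : 0 < H) (hm : H ≤ Φ.mass i v x') :
    ∃ z ∈ (Polynomial.derivative (lineMap (Φ.Λ v x) (lineDir a) (Φ.P i v))).roots,
      Φ.gain i v x' ^ 2 ≤ (1 + rootConst n d) * (1 + H * ‖t - z‖)⁻¹ := by
  obtain ⟨⟨j, hjd⟩, w, A⟩ := a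
  obtain ⟨hj, hsc⟩ := ha
  change 2 ≤ j at hj
  set q := Polynomial.derivative (lineMap (Φ.Λ v x) (lineDir ⟨⟨j, hjd⟩, w, A⟩) (Φ.P i v)) with hq
  -- One derivative is spent in passing to `q`, and at least one must remain to compare `q` with its
  -- roots.
  obtain ⟨j, rfl⟩ : ∃ k, j = k + 1 + 1 := ⟨j - 2, by omega⟩
  change Φ.scale i v x' ^ (j + 1 + 1) ≤ _ at hsc
  have hh := Φ.scale_pos i v x'
  have hmm := Φ.mass_pos i v x'
  have hK := one_le_lineConst n d
  have hR := one_le_rootConst n d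
  have e1 : Φ.lineDeriv i v ⟨⟨j + 1 + 1, hjd⟩, w, A⟩ x' =
      (Polynomial.derivative^[j + 1] q).eval t := by
    rw [hq, ← Function.iterate_succ_apply, iterate_derivative_lineMap, eval_lineMap, ← hx']
    rfl
  have e2 : q.eval t = ∑ s ∈ A, Φ.Q i v [w s] x' := by
    rw [hq, derivative_lineMap, eval_lineMap, ← hx', lineDir, dirDeriv_sum_single, map_sum]
    rfl
  rw [e1] at hsc
  have hq0 : Polynomial.derivative^[j + 1] q ≠ 0 := by
    intro h
    rw [h, Polynomial.eval_zero, norm_zero, mul_zero] at hsc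
    exact absurd hsc (not_le.2 (pow_pos hh _))
  have hdeg : 0 < q.natDegree := by
    by_contra h
    exact hq0 (Polynomial.iterate_derivative_eq_zero (by omega))
  have hqd : q.natDegree ≤ d + 1 := by
    refine (Polynomial.natDegree_derivative_le _).trans ?_
    have := natDegree_lineMap_le (Φ.Λ v x) (lineDir ⟨⟨j + 1 + 1, hjd⟩, w, A⟩) (Φ.P i v)
    have := Φ.deg_le i v
    omega
  have hne : q.roots.toFinset.Nonempty := by
    rw [Multiset.toFinset_nonempty, ← Multiset.card_pos,
      ← (IsAlgClosed.splits q).natDegree_eq_card_roots]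
    exact hdeg
  obtain ⟨z, hz, hmin⟩ := exists_min_image q.roots.toFinset (fun z => ‖t - z‖) hne
  refine ⟨z, Multiset.mem_toFinset.1 hz, ?_⟩
  have hg0 := Φ.gain_pos i v x'
  have hg1 := Φ.gain_le_one i v x'
  have hgm : Φ.gain i v x' * Φ.mass i v x' = Φ.scale i v x' := div_mul_cancel₀ _ hmm.ne'
  rw [← div_eq_mul_inv, le_div_iff₀ (by positivity)]
  -- At a root the claim only asks that the gain be bounded.
  rcases (norm_nonneg (t - z)).eq_or_lt with hδ | hδ
  · rw [← hδ]
    nlinarith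
  set δ := ‖t - z‖
  have hder := norm_iterate_derivative_le q t hδ
    (fun u hu => hmin u (Multiset.mem_toFinset.2 hu)) (j + 1)
  have hgrad : ‖q.eval t‖ ≤ (d + 1) * Φ.mass i v x' := by
    rw [e2]
    refine (norm_sum_le_of_le A fun s _ => Φ.norm_Q_singleton_le i v x' (w s)).trans ?_
    rw [sum_const, nsmul_eq_mul]
    gcongr
    have := card_finset_fin_le A
    exact_mod_cast (by omega : A.card ≤ d + 1)
  -- Dividing `scale ^ (j + 2) * δ ^ (j + 1) ≲ mass` by `mass` leaves one gain. Since the gain is at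
  -- most `1`, raising it to the power `j + 1` only helps and makes the left side a perfect power.
  have hmain : (Φ.scale i v x' * δ * Φ.gain i v x') ^ (j + 1) ≤ rootConst n d ^ (j + 1) := by
    have h1 : Φ.scale i v x' ^ (j + 1 + 1) * δ ^ (j + 1) ≤ rootConst n d * Φ.mass i v x' := by
      calc Φ.scale i v x' ^ (j + 1 + 1) * δ ^ (j + 1)
          ≤ lineConst n d * ‖(Polynomial.derivative^[j + 1] q).eval t‖ * δ ^ (j + 1) := by gcongr
        _ = lineConst n d * (‖(Polynomial.derivative^[j + 1] q).eval t‖ * δ ^ (j + 1)) := by ring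
        _ ≤ lineConst n d * ((q.natDegree : ℝ) ^ (j + 1) * ((d + 1) * Φ.mass i v x')) := by
            exact mul_le_mul_of_nonneg_left (hder.trans (by gcongr)) (zero_le_one.trans hK)
        _ ≤ lineConst n d * (((d : ℝ) + 1) ^ (j + 1) * ((d + 1) * Φ.mass i v x')) := by
            gcongr
            exact_mod_cast hqd
        _ = lineConst n d * ((d : ℝ) + 1) ^ (j + 1 + 1) * Φ.mass i v x' := by ring
        _ ≤ rootConst n d * Φ.mass i v x' := by
            rw [rootConst]
            gcongr
            simp
    have h2 : (Φ.scale i v x' * δ) ^ (j + 1) * Φ.gain i v x' ≤ rootConst n d := by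
      refine le_of_mul_le_mul_right ?_ hmm
      calc (Φ.scale i v x' * δ) ^ (j + 1) * Φ.gain i v x' * Φ.mass i v x'
          = Φ.scale i v x' ^ (j + 1 + 1) * δ ^ (j + 1) := by rw [mul_assoc, hgm]; ring
        _ ≤ _ := h1
    calc (Φ.scale i v x' * δ * Φ.gain i v x') ^ (j + 1)
        = (Φ.scale i v x' * δ) ^ (j + 1) * Φ.gain i v x' ^ (j + 1) := mul_pow _ _ _
      _ ≤ (Φ.scale i v x' * δ) ^ (j + 1) * Φ.gain i v x' := by
          gcongr
          exact pow_le_of_le_one hg0.le hg1 (by omega)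
      _ ≤ rootConst n d := h2
      _ ≤ _ := le_self_pow₀ hR (by omega)
  have h3 := (pow_le_pow_iff_left₀ (by positivity) (by positivity) (by omega)).1 hmain
  -- Writing `scale = gain * mass` and `mass ≥ H` gives the second power of the gain.
  have h4 : H * δ * Φ.gain i v x' ^ 2 ≤ rootConst n d := by
    refine le_trans ?_ h3
    rw [← hgm]
    calc H * δ * Φ.gain i v x' ^ 2 ≤ Φ.mass i v x' * δ * Φ.gain i v x' ^ 2 := by gcongr
      _ = _ := by ring
  nlinarith [pow_le_one₀ (n := 2) hg0.le hg1]

end PhaseSystem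


/-! ### Averaging over lines and removing the cut-offs place by place. -/

namespace PhaseSystem

open MvPolynomial Finset MeasureTheory Module

variable {V ι 𝒱 : Type*} [NormedAddCommGroup V] [NormedSpace ℝ V] {n d : ℕ}
  (Φ : PhaseSystem V ι 𝒱 n d)

theorem measurableSet_lineSet [MeasurableSpace V] [BorelSpace V] (i : ι) (v : 𝒱) (a : LineIndex n d) :
    MeasurableSet (Φ.lineSet i v a) := by
  refine MeasurableSet.inter (MeasurableSet.const _) (IsClosed.measurableSet ?_)
  refine isClosed_le ((Φ.continuous_scale i v).pow _) (continuous_const.mul (Continuous.norm ?_))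
  exact ((contDiff_eval _).continuous).comp (Φ.Λ v).continuous

section Line

variable {F : Type*} [NormedAddCommGroup F] [NormedSpace ℝ F]

/-- The translation of `V` that moves `Λ_v` along a direction. -/
def shift (v : 𝒱) (κ : F →ₗ[ℝ] ℂ) (a : LineIndex n d) : F →ₗ[ℝ] V :=
  ∑ s ∈ a.2.2, (Φ.e v (a.2.1 s)).comp κ

theorem Λ_shift {v : 𝒱} {κ : F →ₗ[ℝ] ℂ} (hκ : ∀ t, Φ.proj v (κ t) = κ t) (a : LineIndex n d)
    (x : V) (t : F) :
    Φ.Λ v (x + Φ.shift v κ a t) = fun l => Φ.Λ v x l + κ t * lineDir a l := by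
  funext l
  simp [shift, lineDir, LinearMap.sum_apply, Φ.Λ_e_same, hκ, Pi.single_apply, Finset.sum_ite, mul_comm]

theorem comp_shift_eq {β : Type*} {v : 𝒱} (κ : F →ₗ[ℝ] ℂ) (a : LineIndex n d) {g : V → β}
    (hg : ∀ x l c, g (x + Φ.e v l c) = g x) (x : V) (t : F) :
    g (x + Φ.shift v κ a t) = g x := by
  classical
  simp only [shift, LinearMap.sum_apply, LinearMap.comp_apply]
  induction a.2.2 using Finset.induction_on generalizing x with
  | empty => simp
  | insert s A hs ih => rw [sum_insert hs, ← add_assoc, ih, hg]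

variable [FiniteDimensional ℝ F] [MeasurableSpace F] [BorelSpace F] (νF : Measure F)
  [νF.IsAddHaarMeasure]

/-- Along each line, the part of the cut-off where the line realizes the scale has small
integral. -/
theorem exists_lintegral_line_le {v : 𝒱} {κ : F →ₗ[ℝ] ℂ} (hκ : ∀ t, Φ.proj v (κ t) = κ t)
    {r : ℂ → F} (hr : ∀ t z, ‖t - r z‖ ≤ ‖κ t - z‖) (hF : finrank ℝ F ≤ 2) :
    ∃ C : ℝ≥0, ∀ i (a : LineIndex n d) (H : ℝ), 1 ≤ H → ∀ x,
      ∫⁻ t, (Φ.lineSet i v a).indicator (Φ.cut i v H) (x + Φ.shift v κ a t) ∂νF ≤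
        C * ENNReal.ofReal ((H ^ finrank ℝ F)⁻¹) := by
  obtain ⟨C, hC⟩ := exists_lintegral_decay_le νF
  refine ⟨d * (Real.toNNReal ((1 + rootConst n d) ^ (finrank ℝ F + 1)) * C),
    fun i a H hH x => ?_⟩
  have hH0 : 0 < H := zero_lt_one.trans_le hH
  have hR := one_le_rootConst n d
  set q := Polynomial.derivative (lineMap (Φ.Λ v x) (lineDir a) (Φ.P i v)) with hq
  have hqd : q.roots.card ≤ d := by
    refine (Polynomial.card_roots' q).trans ((Polynomial.natDegree_derivative_le _).trans ?_)
    have := natDegree_lineMap_le (Φ.Λ v x) (lineDir a) (Φ.P i v)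
    have := Φ.deg_le i v
    omega
  let bump : ℂ → F → ℝ≥0∞ := fun z t =>
    ENNReal.ofReal ((1 + rootConst n d) ^ (finrank ℝ F + 1)) *
      ENNReal.ofReal (((1 + H * ‖t - r z‖) ^ (finrank ℝ F + 1))⁻¹)
  have hpt : ∀ t, (Φ.lineSet i v a).indicator (Φ.cut i v H) (x + Φ.shift v κ a t) ≤
      ∑ z ∈ q.roots.toFinset, bump z t := by
    intro t
    by_cases h1 : x + Φ.shift v κ a t ∈ Φ.lineSet i v a
    swap
    · rw [Set.indicator_of_notMem h1]; exact zero_le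
    rw [Set.indicator_of_mem h1, cut]
    by_cases h2 : H ≤ Φ.mass i v (x + Φ.shift v κ a t)
    swap
    · rw [Set.indicator_of_notMem (by simpa using h2)]; exact zero_le
    rw [Set.indicator_of_mem (by simpa using h2)]
    obtain ⟨z, hz, hgz⟩ := Φ.exists_root_gain_sq_le i v a x _ (κ t) (Φ.Λ_shift hκ a x t) h1 hH0 h2
    refine le_trans ?_ (single_le_sum (f := fun z => bump z t) (fun _ _ => zero_le)
      (Multiset.mem_toFinset.2 hz))
    simp only [bump]
    rw [← ENNReal.ofReal_mul (by positivity)]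
    refine ENNReal.ofReal_le_ofReal ?_
    have hg0 := Φ.gain_pos i v (x + Φ.shift v κ a t)
    have hg1 := Φ.gain_le_one i v (x + Φ.shift v κ a t)
    -- The exponent `6` is `2 (m + 1)` for the largest dimension `m = 2`: each square of the gain
    -- supplies one power of the bump, and `m + 1` powers are integrable.
    calc Φ.gain i v (x + Φ.shift v κ a t) ^ 6
        ≤ Φ.gain i v (x + Φ.shift v κ a t) ^ (2 * (finrank ℝ F + 1)) :=
          pow_le_pow_of_le_one hg0.le hg1 (by omega)
      _ = (Φ.gain i v (x + Φ.shift v κ a t) ^ 2) ^ (finrank ℝ F + 1) := pow_mul _ _ _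
      _ ≤ ((1 + rootConst n d) * (1 + H * ‖t - r z‖)⁻¹) ^ (finrank ℝ F + 1) := by
          refine pow_le_pow_left₀ (by positivity) (hgz.trans ?_) _
          have := hr t z
          gcongr
      _ = _ := by rw [mul_pow, inv_pow]
  calc _ ≤ ∫⁻ t, ∑ z ∈ q.roots.toFinset, bump z t ∂νF := lintegral_mono hpt
    _ = ∑ z ∈ q.roots.toFinset, ∫⁻ t, bump z t ∂νF :=
        lintegral_finsetSum _ fun z _ => by simp only [bump]; fun_prop
    _ ≤ ∑ _z ∈ q.roots.toFinset, ENNReal.ofReal ((1 + rootConst n d) ^ (finrank ℝ F + 1)) *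
          (C * ENNReal.ofReal ((H ^ finrank ℝ F)⁻¹)) := by
        refine sum_le_sum fun z _ => ?_
        rw [lintegral_const_mul' _ _ ENNReal.ofReal_ne_top]
        gcongr
        exact hC H hH0 (r z)
    _ ≤ d * (ENNReal.ofReal ((1 + rootConst n d) ^ (finrank ℝ F + 1)) *
          (C * ENNReal.ofReal ((H ^ finrank ℝ F)⁻¹))) := by
        rw [sum_const, nsmul_eq_mul]
        gcongr
        exact (Multiset.toFinset_card_le _).trans hqd
    _ = _ := by
        push_cast
        rw [ENNReal.ofReal]
        ring

variable [FiniteDimensional ℝ V] [MeasurableSpace V] [BorelSpace V] (ν : Measure V)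
  [ν.IsAddHaarMeasure]

/-- Averaging over translations: a function that is small on average along the translates
by a linear family of vectors has small integral against an invariant weight. -/
theorem lintegral_mul_le_of_average (U : F →ₗ[ℝ] V) {k g : V → ℝ≥0∞} (hk : Measurable k)
    (hg : Measurable g) (hinv : ∀ x t, g (x + U t) = g x) {c : ℝ≥0∞} (hc : ∀ x,
      ∫⁻ t, k (x + U t) ∂νF ≤ c) (R : ℝ) :
    νF (Metric.closedBall 0 1) * ∫⁻ x in Metric.closedBall 0 R, k x * g x ∂ν ≤
      c * ∫⁻ x in Metric.closedBall 0 (R + ‖U.toContinuousLinearMap‖), g x ∂ν := by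
  set R' := R + ‖U.toContinuousLinearMap‖
  have hU : Continuous U := U.continuous_of_finiteDimensional
  -- Translating by `U t` leaves `g` unchanged and, for `t` in the unit ball, enlarges the domain by
  -- at most the operator norm. Averaging over `t` and exchanging the integrals then exposes the
  -- line integral of `k`.
  have h1 : ∀ t ∈ Metric.closedBall (0 : F) 1,
      ∫⁻ x in Metric.closedBall 0 R, k x * g x ∂ν ≤
        ∫⁻ x in Metric.closedBall 0 R', k (x + U t) * g x ∂ν := by
    intro t ht
    rw [← lintegral_indicator measurableSet_closedBall,
      ← lintegral_indicator measurableSet_closedBall,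
      ← lintegral_add_right_eq_self (μ := ν) _ (U t)]
    refine lintegral_mono fun x => ?_
    by_cases hx : x + U t ∈ Metric.closedBall (0 : V) R
    · have hx' : x ∈ Metric.closedBall (0 : V) R' := by
        rw [mem_closedBall_zero_iff] at hx ht ⊢
        have h2 : ‖U t‖ ≤ ‖U.toContinuousLinearMap‖ := by
          have := U.toContinuousLinearMap.le_opNorm t
          calc ‖U t‖ ≤ ‖U.toContinuousLinearMap‖ * ‖t‖ := this
            _ ≤ ‖U.toContinuousLinearMap‖ := mul_le_of_le_one_right (norm_nonneg _) ht
        calc ‖x‖ = ‖x + U t - U t‖ := by rw [add_sub_cancel_right]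
          _ ≤ ‖x + U t‖ + ‖U t‖ := norm_sub_le _ _
          _ ≤ R' := add_le_add hx h2
      rw [Set.indicator_of_mem hx, Set.indicator_of_mem hx', hinv]
    · rw [Set.indicator_of_notMem hx]
      exact zero_le
  have hmeas : Measurable fun p : F × V => k (p.2 + U p.1) * g p.2 :=
    (hk.comp (measurable_snd.add (hU.measurable.comp measurable_fst))).mul (hg.comp measurable_snd)
  calc νF (Metric.closedBall 0 1) * ∫⁻ x in Metric.closedBall 0 R, k x * g x ∂ν
      = ∫⁻ _t in Metric.closedBall (0 : F) 1, ∫⁻ x in Metric.closedBall 0 R, k x * g x ∂ν ∂νF := by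
        rw [setLIntegral_const, mul_comm]
    _ ≤ ∫⁻ t in Metric.closedBall (0 : F) 1,
          ∫⁻ x in Metric.closedBall 0 R', k (x + U t) * g x ∂ν ∂νF :=
        setLIntegral_mono' measurableSet_closedBall h1
    _ ≤ ∫⁻ t, ∫⁻ x in Metric.closedBall 0 R', k (x + U t) * g x ∂ν ∂νF :=
        setLIntegral_le_lintegral _ _
    _ = ∫⁻ x in Metric.closedBall 0 R', ∫⁻ t, k (x + U t) * g x ∂νF ∂ν :=
        lintegral_lintegral_swap hmeas.aemeasurable
    _ ≤ ∫⁻ x in Metric.closedBall 0 R', c * g x ∂ν := by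
        refine lintegral_mono fun x => ?_
        rw [lintegral_mul_const _ (by fun_prop)]
        gcongr
        exact hc x
    _ = _ := lintegral_const_mul _ hg

/-- The cut-off at one place may be removed from an integral at the cost of a power of `H`. -/
def Removable (v : 𝒱) (m : ℕ) : Prop :=
  ∀ R : ℝ, ∃ (C : ℝ≥0) (R' : ℝ), ∀ i (H : ℝ), 1 ≤ H → ∀ g : V → ℝ≥0∞, Measurable g →
    (∀ x l c, g (x + Φ.e v l c) = g x) →
    ∫⁻ x in Metric.closedBall 0 R, Φ.cut i v H x * g x ∂ν ≤
      C * ENNReal.ofReal ((H ^ m)⁻¹) * ∫⁻ x in Metric.closedBall 0 R', g x ∂ν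

/-- The cut-off is at most `(d + 1) ^ 6 / H ^ m` plus its restrictions to the finitely many line
sets. Each restriction is averaged along its own direction, where it has small line integrals. -/
theorem removable_of_coordinate {v : 𝒱} {κ : F →ₗ[ℝ] ℂ} (hκ : ∀ t, Φ.proj v (κ t) = κ t)
    {r : ℂ → F} (hr : ∀ t z, ‖t - r z‖ ≤ ‖κ t - z‖) (hF : finrank ℝ F ≤ 2) :
    Φ.Removable ν v (finrank ℝ F) := by
  intro R
  let νF : Measure F := Measure.addHaar
  obtain ⟨C, hC⟩ := Φ.exists_lintegral_line_le νF hκ hr hF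
  set R' := R + ∑ a : LineIndex n d, ‖(Φ.shift v κ a).toContinuousLinearMap‖
  set b := νF (Metric.closedBall 0 1) with hb
  have hb0 : b ≠ 0 := (Metric.measure_closedBall_pos νF 0 one_pos).ne'
  have hbt : b ≠ ⊤ := measure_closedBall_lt_top.ne
  refine ⟨Real.toNNReal ((d + 1) ^ 6) + Fintype.card (LineIndex n d) * (b⁻¹.toNNReal * C), R',
    fun i H hH g hg hinv => ?_⟩
  have hH0 : 0 < H := zero_lt_one.trans_le hH
  set I := ∫⁻ x in Metric.closedBall 0 R', g x ∂ν
  have hpt : ∀ x, Φ.cut i v H x * g x ≤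
      ENNReal.ofReal ((d + 1) ^ 6) * ENNReal.ofReal ((H ^ finrank ℝ F)⁻¹) * g x +
        ∑ a, (Φ.lineSet i v a).indicator (Φ.cut i v H) x * g x := by
    intro x
    rw [← sum_mul, ← add_mul]
    gcongr
    by_cases h2 : H ≤ Φ.mass i v x
    swap
    · rw [cut, Set.indicator_of_notMem (by simpa using h2)]; exact zero_le
    rcases Φ.gain_le_or_mem_lineSet i v x hH0 h2 with h | ⟨a, ha⟩
    · refine le_add_right ?_
      rw [cut, Set.indicator_of_mem (by simpa using h2), ← ENNReal.ofReal_mul (by positivity)]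
      refine ENNReal.ofReal_le_ofReal ?_
      refine (pow_le_pow_left₀ (Φ.gain_pos i v x).le h 6).trans ?_
      rw [div_pow, div_eq_mul_inv]
      gcongr
      omega
    · refine le_add_left ?_
      refine le_trans (le_of_eq ?_) (single_le_sum (f := fun a =>
        (Φ.lineSet i v a).indicator (Φ.cut i v H) x) (fun _ _ => zero_le) (mem_univ a))
      simp only [Set.indicator_of_mem ha]
  have hk : ∀ a, Measurable ((Φ.lineSet i v a).indicator (Φ.cut i v H)) := fun a =>
    (Φ.measurable_cut i v H).indicator (Φ.measurableSet_lineSet i v a)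
  have hRa : ∀ a : LineIndex n d, R + ‖(Φ.shift v κ a).toContinuousLinearMap‖ ≤ R' := fun a =>
    add_le_add_right (single_le_sum (f := fun a : LineIndex n d =>
      ‖(Φ.shift v κ a).toContinuousLinearMap‖) (fun _ _ => norm_nonneg _) (mem_univ a)) R
  have hRR : R ≤ R' := le_add_of_nonneg_right (sum_nonneg fun _ _ => norm_nonneg _)
  have hline : ∀ a, ∫⁻ x in Metric.closedBall 0 R,
      (Φ.lineSet i v a).indicator (Φ.cut i v H) x * g x ∂ν ≤
        b⁻¹ * (C * ENNReal.ofReal ((H ^ finrank ℝ F)⁻¹) * I) := by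
    intro a
    rw [← ENNReal.mul_le_iff_le_inv hb0 hbt]
    refine (lintegral_mul_le_of_average νF ν (Φ.shift v κ a) (hk a) hg
      (fun x t => Φ.comp_shift_eq κ a hinv x t) (hC i a H hH) R).trans ?_
    gcongr
    exact lintegral_mono_set (Metric.closedBall_subset_closedBall (hRa a))
  calc _ ≤ ∫⁻ x in Metric.closedBall 0 R,
        (ENNReal.ofReal ((d + 1) ^ 6) * ENNReal.ofReal ((H ^ finrank ℝ F)⁻¹) * g x +
        ∑ a, (Φ.lineSet i v a).indicator (Φ.cut i v H) x * g x) ∂ν := lintegral_mono hpt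
    _ = ENNReal.ofReal ((d + 1) ^ 6) * ENNReal.ofReal ((H ^ finrank ℝ F)⁻¹) *
          ∫⁻ x in Metric.closedBall 0 R, g x ∂ν +
        ∑ a, ∫⁻ x in Metric.closedBall 0 R,
          (Φ.lineSet i v a).indicator (Φ.cut i v H) x * g x ∂ν := by
        rw [lintegral_add_left (by fun_prop), lintegral_const_mul _ hg,
          lintegral_finsetSum (μ := ν.restrict _) (f := fun a x =>
            (Φ.lineSet i v a).indicator (Φ.cut i v H) x * g x) _ fun a _ => (hk a).mul hg]
    _ ≤ ENNReal.ofReal ((d + 1) ^ 6) * ENNReal.ofReal ((H ^ finrank ℝ F)⁻¹) * I +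
        ∑ _a : LineIndex n d, b⁻¹ * (C * ENNReal.ofReal ((H ^ finrank ℝ F)⁻¹) * I) := by
        gcongr with a
        · exact lintegral_mono_set (Metric.closedBall_subset_closedBall hRR)
        · exact hline a
    _ = _ := by
        rw [sum_const, nsmul_eq_mul, card_univ]
        push_cast
        rw [ENNReal.coe_toNNReal (ENNReal.inv_ne_top.2 hb0), ENNReal.ofReal]
        ring

/-- The cut-offs at other places are invariant under the moves at `v`, so they serve as the weight
`g` while the cut-off at `v` is removed. The ball grows at each removal, hence the induction for all
radii. -/
theorem exists_lintegral_prod_cut_le {m : 𝒱 → ℕ} (hm : ∀ v, Φ.Removable ν v (m v)) (A : Finset 𝒱)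
    (R : ℝ) : ∃ C : ℝ≥0, ∀ i (H : 𝒱 → ℝ), (∀ v ∈ A, 1 ≤ H v) →
      ∫⁻ x in Metric.closedBall 0 R, ∏ v ∈ A, Φ.cut i v (H v) x ∂ν ≤
        C * ∏ v ∈ A, ENNReal.ofReal ((H v ^ m v)⁻¹) := by
  classical
  induction A using Finset.induction_on generalizing R with
  | empty =>
    refine ⟨(ν (Metric.closedBall 0 R)).toNNReal, fun i H _ => ?_⟩
    simp [ENNReal.coe_toNNReal measure_closedBall_lt_top.ne]
  | insert v A hv ih =>
    obtain ⟨C₁, R', h₁⟩ := hm v R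
    obtain ⟨C₂, h₂⟩ := ih R'
    refine ⟨C₁ * C₂, fun i H hH => ?_⟩
    simp only [prod_insert hv]
    refine (h₁ i (H v) (hH v (mem_insert_self v A)) (fun x => ∏ v ∈ A, Φ.cut i v (H v) x)
      (Finset.measurable_prod _ fun v _ => Φ.measurable_cut i v (H v)) fun x l c => ?_).trans ?_
    · refine prod_congr rfl fun v' hv' => Φ.cut_add_e i ?_ _ x l c
      rintro rfl
      exact hv hv'
    · calc _ ≤ C₁ * ENNReal.ofReal ((H v ^ m v)⁻¹) *
            (C₂ * ∏ v ∈ A, ENNReal.ofReal ((H v ^ m v)⁻¹)) := by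
            gcongr
            exact h₂ i H fun v' hv' => hH v' (mem_insert_of_mem hv')
        _ = _ := by push_cast; ring

end Line

end PhaseSystem


/-! ### Embeddings, places and the trace. -/

open MvPolynomial NumberField NumberField.InfinitePlace

variable {K : Type*} [Field K] {k n d : ℕ} [NumberField K] (B : Module.Basis (Fin k) ℚ K)

section Embeddings

theorem sigmaStarStar_eq_linearCombination (σ : K →+* ℂ) (x : Fin k → ℝ) :
    sigmaStarStar B σ x = Fintype.linearCombination ℝ (fun j => σ (B j)) x := by
  simp [sigmaStarStar, Fintype.linearCombination_apply]

theorem conj_sigmaStarStar (σ : K →+* ℂ) (x : Fin k → ℝ) :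
    (starRingEnd ℂ) (sigmaStarStar B σ x) =
      sigmaStarStar B (ComplexEmbedding.conjugate σ) x := by
  simp [sigmaStarStar, ComplexEmbedding.conjugate_coe_eq]

theorem conj_sigmaStar (σ : K →+* ℂ) (M : realAlg B) :
    (starRingEnd ℂ) (sigmaStar B σ M) = sigmaStar B (ComplexEmbedding.conjugate σ) M :=
  conj_sigmaStarStar B σ _

/-- Both sides are real-linear in the coordinates, so it suffices to compare them on the basis,
where this is the formula for the field trace as a sum of embeddings. -/
theorem trStar_eq_sum (M : realAlg B) : (trStar B M : ℂ) = ∑ σ : K →+* ℂ, sigmaStar B σ M := by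
  obtain ⟨_, x, rfl⟩ := M
  change ((Matrix.trace (mulMatrixStar B x) : ℝ) : ℂ) = ∑ σ, sigmaStar B σ (toRealAlg B x)
  simp only [sigmaStar_toRealAlg, sigmaStarStar]
  rw [Finset.sum_comm, mulMatrixStar_apply, Matrix.trace_sum, Complex.ofReal_sum]
  refine Finset.sum_congr rfl fun j _ => ?_
  rw [Matrix.trace_smul, smul_eq_mul, Complex.ofReal_mul, ← Finset.mul_sum]
  congr 1
  have h := trace_eq_sum_embeddings (K := ℚ) (L := K) ℂ (x := B j)
  rw [Algebra.trace_eq_matrix_trace B] at h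
  have h2 : Matrix.trace (mulMatrix B (B j)) =
      ((Matrix.trace (Algebra.leftMulMatrix B (B j)) : ℚ) : ℝ) := by
    simp [mulMatrix, Matrix.trace]
  rw [h2]
  refine Eq.trans ?_ (h.trans ?_)
  · simp
  · exact Fintype.sum_equiv (RingHom.equivRatAlgHom (R := K) (S := ℂ)).symm _ _ fun σ => rfl

theorem sum_embeddings_eq_sum_places {β : Type*} [AddCommMonoid β] (g : InfinitePlace K → β) :
    ∑ σ : K →+* ℂ, g (mk σ) = ∑ v, mult v • g v := by
  classical
  rw [← Finset.sum_fiberwise_of_maps_to (g := mk) (t := Finset.univ) fun _ _ => Finset.mem_univ _]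
  refine Finset.sum_congr rfl fun v _ => ?_
  rw [← card_filter_mk_eq v, ← Finset.sum_const]
  convert Finset.sum_congr rfl fun σ hσ => ?_
  rw [(Finset.mem_filter.1 hσ).2]

/-- The coordinate of a place to which a complex number contributes. -/
def placeProj (v : InfinitePlace K) (c : ℂ) : ℂ :=
  open scoped Classical in if v.IsReal then (c.re : ℂ) else c

/-- An integral basis of `K` spans the mixed space over `ℝ`, and its members are rational
combinations of `B`. This supplies the independence of the places. -/
theorem span_mixedEmbedding_basis :
    Submodule.span ℝ (Set.range fun j => mixedEmbedding K (B j)) = ⊤ := by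
  rw [eq_top_iff, ← (mixedEmbedding.latticeBasis K).span_eq, Submodule.span_le]
  rintro _ ⟨i, rfl⟩
  rw [mixedEmbedding.latticeBasis_apply]
  generalize integralBasis K i = q
  rw [← B.sum_repr q, map_sum]
  refine Submodule.sum_mem _ fun j _ => ?_
  have h : mixedEmbedding K (B.repr q j • B j) =
      ((B.repr q j : ℚ) : ℝ) • mixedEmbedding K (B j) := by
    rw [Algebra.smul_def, map_mul]
    ext w <;> simp
  rw [h]
  exact Submodule.smul_mem _ _ (Submodule.subset_span ⟨j, rfl⟩)

/-- Vectors of `ℝ^k` dual to the embeddings attached to the infinite places. -/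
theorem exists_dual_vectors : ∃ b : InfinitePlace K → ℂ →ₗ[ℝ] (Fin k → ℝ),
    (∀ v c, sigmaStarStar B v.embedding (b v c) = placeProj v c) ∧
      ∀ v w c, v ≠ w → sigmaStarStar B w.embedding (b v c) = 0 := by
  classical
  let E : (Fin k → ℝ) →ₗ[ℝ] mixedEmbedding.mixedSpace K :=
    Fintype.linearCombination ℝ fun j => mixedEmbedding K (B j)
  have hE : LinearMap.range E = ⊤ := by
    rw [Fintype.range_linearCombination, span_mixedEmbedding_basis]
  obtain ⟨s, hs⟩ := E.exists_rightInverse_of_surjective hE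
  have hs' : ∀ y, E (s y) = y := fun y => LinearMap.congr_fun hs y
  have hre : ∀ (w : InfinitePlace K) (hw : IsReal w) x,
      sigmaStarStar B w.embedding x = ((E x).1 ⟨w, hw⟩ : ℂ) := by
    intro w hw x
    simp only [E, Fintype.linearCombination_apply, Prod.fst_sum, Finset.sum_apply, Prod.smul_fst,
      Pi.smul_apply, mixedEmbedding.mixedEmbedding_apply_isReal, smul_eq_mul, sigmaStarStar,
      Complex.ofReal_sum, Complex.ofReal_mul, embedding_of_isReal_apply hw]
  have hco : ∀ (w : InfinitePlace K) (hw : IsComplex w) x,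
      sigmaStarStar B w.embedding x = (E x).2 ⟨w, hw⟩ := by
    intro w hw x
    simp only [E, Fintype.linearCombination_apply, Prod.snd_sum, Finset.sum_apply, Prod.smul_snd,
      Pi.smul_apply, mixedEmbedding.mixedEmbedding_apply_isComplex, sigmaStarStar,
      Complex.real_smul]
  let b : InfinitePlace K → ℂ →ₗ[ℝ] mixedEmbedding.mixedSpace K := fun v =>
    if h : IsReal v then
      (LinearMap.inl ℝ _ _).comp ((LinearMap.single ℝ (fun _ => ℝ) ⟨v, h⟩).comp Complex.reLm)
    else
      (LinearMap.inr ℝ _ _).comp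
        (LinearMap.single ℝ (fun _ => ℂ) ⟨v, not_isReal_iff_isComplex.1 h⟩)
  refine ⟨fun v => s.comp (b v), fun v c => ?_, fun v w c hvw => ?_⟩
  · rcases isReal_or_isComplex v with h | h
    · rw [hre v h, LinearMap.comp_apply, hs', placeProj, if_pos h]
      simp [b, h]
    · have h' := not_isReal_iff_isComplex.2 h
      rw [hco v h, LinearMap.comp_apply, hs', placeProj, if_neg h']
      simp [b, h']
  · have hne : ∀ h1 h2, (⟨w, h1⟩ : {w : InfinitePlace K // IsReal w}) ≠ ⟨v, h2⟩ := fun _ _ h =>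
      hvw (congrArg Subtype.val h).symm
    have hne' : ∀ h1 h2, (⟨w, h1⟩ : {w : InfinitePlace K // IsComplex w}) ≠ ⟨v, h2⟩ := fun _ _ h =>
      hvw (congrArg Subtype.val h).symm
    rcases isReal_or_isComplex w with h | h
    · rw [hre w h, LinearMap.comp_apply, hs']
      by_cases hv : IsReal v <;> simp [b, hv, hne]
    · rw [hco w h, LinearMap.comp_apply, hs']
      by_cases hv : IsReal v <;> simp [b, hv, hne']

end Embeddings

/-! ### Conjugate polynomials and the `H`-functionals. -/

section Polynomials

variable (f : MvPolynomial (Fin n) (realAlg B)) (σ : K →+* ℂ) (x : Fin n → Fin k → ℝ)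

theorem eval_map_sigmaStar :
    eval (fun l => sigmaStarStar B σ (x l)) (map (sigmaStar B σ) f) =
      sigmaStar B σ (eval (fun l => toRealAlg B (x l)) f) := by
  simp only [← sigmaStar_toRealAlg]
  rw [eval_map, ← eval₂_id, eval₂_comp_left]
  rfl

/-- The iterated partial derivative along a word, over `(ℝ ⊗_ℚ K)_B`. -/
def realWordDeriv (w : List (Fin n)) (f : MvPolynomial (Fin n) (realAlg B)) :
    MvPolynomial (Fin n) (realAlg B) :=
  w.foldr (fun l g => pderiv l g) f

theorem wordDeriv_conjPoly (w : List (Fin n)) :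
    wordDeriv w (conjPoly B f σ) = map (sigmaStar B σ) (realWordDeriv B w f) := by
  induction w with
  | nil => rfl
  | cons l w ih => rw [wordDeriv_cons, ih, pderiv_map]; rfl

/-- Differentiation commutes with applying `σ^*` to coefficients, and complex conjugation carries
`σ^*` to the one of the conjugate embedding. Hence derivatives at real places are real, and
conjugate embeddings share their `H`-functional. -/
theorem conj_eval_wordDeriv (w : List (Fin n)) :
    (starRingEnd ℂ) (eval (fun l => sigmaStarStar B σ (x l)) (wordDeriv w (conjPoly B f σ))) =
      eval (fun l => sigmaStarStar B (ComplexEmbedding.conjugate σ) (x l))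
        (wordDeriv w (conjPoly B f (ComplexEmbedding.conjugate σ))) := by
  rw [wordDeriv_conjPoly, wordDeriv_conjPoly, eval_map_sigmaStar, eval_map_sigmaStar,
    conj_sigmaStar]

/-- The sorted word of a multi-index. -/
def sortedWord (α : Fin n → ℕ) : List (Fin n) :=
  (List.finRange n).flatMap fun l => List.replicate (α l) l

theorem length_sortedWord (α : Fin n → ℕ) : (sortedWord α).length = ∑ l, α l := by
  simp [sortedWord, List.length_flatMap, Fin.sum_univ_def]

theorem partialDeriv_eq_wordDeriv (α : Fin n → ℕ) (P : MvPolynomial (Fin n) ℂ) :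
    partialDeriv α P = wordDeriv (sortedWord α) P := by
  rw [partialDeriv, wordDeriv, sortedWord, List.foldr_flatMap]
  congr 1
  funext l Q
  generalize α l = m
  induction m with
  | zero => rfl
  | succ m ih => rw [Function.iterate_succ_apply', ih, List.replicate_succ, List.foldr_cons]

theorem hPoint_conjugate :
    hPoint B f (ComplexEmbedding.conjugate σ) x = hPoint B f σ x := by
  have h : ∀ α : Fin n → ℕ, ‖eval (fun l => sigmaStarStar B (ComplexEmbedding.conjugate σ) (x l))
      (partialDeriv α (conjPoly B f (ComplexEmbedding.conjugate σ)))‖ₑ =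
      ‖eval (fun l => sigmaStarStar B σ (x l)) (partialDeriv α (conjPoly B f σ))‖ₑ := by
    intro α
    rw [partialDeriv_eq_wordDeriv, partialDeriv_eq_wordDeriv, ← conj_eval_wordDeriv, ← ofReal_norm,
      ← ofReal_norm, RCLike.norm_conj]
  simp only [hPoint, enorm_mul, h]

theorem hUnif_eq_embedding_mk (ψ : (Fin n → Fin k → ℝ) → ℂ) :
    hUnif B f σ ψ = hUnif B f (mk σ).embedding ψ := by
  rcases mk_eq_iff.1 (mk_embedding (mk σ)) with h | h
  · rw [h]
  · conv_lhs => rw [← h]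
    simp only [hUnif, hPoint_conjugate]

/-- Closure under conjugation makes `S` a union of full fibres of `mk`, and the fibre over `v` has
`mult v` elements. -/
theorem hSet_eq_prod_places [DecidableEq (InfinitePlace K)] (S : Finset (K →+* ℂ))
    (hS : ∀ τ, τ ∈ S ↔ ComplexEmbedding.conjugate τ ∈ S) (ψ : (Fin n → Fin k → ℝ) → ℂ) :
    hSet B f S ψ = ∏ v ∈ S.image mk, hUnif B f v.embedding ψ ^ mult v := by
  classical
  rw [hSet, Finset.prod_congr rfl fun σ _ => hUnif_eq_embedding_mk B f σ ψ,
    Finset.prod_comp (fun v : InfinitePlace K => hUnif B f v.embedding ψ) mk]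
  refine Finset.prod_congr rfl fun v hv => ?_
  obtain ⟨τ, hτ, rfl⟩ := Finset.mem_image.1 hv
  rw [← card_filter_mk_eq]
  congr 2
  ext σ
  simp only [Finset.mem_filter, Finset.mem_univ, true_and, and_iff_right_iff_imp]
  intro h
  rcases mk_eq_iff.1 h with h | h
  · rwa [h]
  · rwa [hS, h]

end Polynomials


open MvPolynomial NumberField NumberField.InfinitePlace MeasureTheory

variable {K : Type*} [Field K] {k n d : ℕ} [NumberField K] (B : Module.Basis (Fin k) ℚ K)

/-! ### The phase system of a number field. -/

section System

/-- The coordinates of the places on `(ℝ^k)^n`. -/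
def placeCoord (v : InfinitePlace K) : (Fin n → Fin k → ℝ) →L[ℝ] (Fin n → ℂ) :=
  LinearMap.toContinuousLinearMap <| LinearMap.pi fun l =>
    (Fintype.linearCombination ℝ fun j => v.embedding (B j)).comp (LinearMap.proj l)

theorem placeCoord_apply (v : InfinitePlace K) (x : Fin n → Fin k → ℝ) :
    placeCoord B v x = fun l => sigmaStarStar B v.embedding (x l) := by
  funext l
  rw [sigmaStarStar_eq_linearCombination]
  rfl

/-- The polynomials of degree at most `d` over `(ℝ ⊗_ℚ K)_B`. -/
abbrev BoundedPoly (n d : ℕ) :=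
  {f : MvPolynomial (Fin n) (realAlg B) // f.totalDegree ≤ d}

/-- The phases of the oscillatory integrals, as a phase system indexed by the infinite places. -/
def phaseSystem (n d : ℕ) :
    PhaseSystem (Fin n → Fin k → ℝ) (BoundedPoly B n d) (InfinitePlace K) n d where
  Λ := placeCoord B
  e v l := (LinearMap.single ℝ (fun _ => Fin k → ℝ) l).comp ((exists_dual_vectors B).choose v)
  proj := placeProj
  Λ_e_same v l c := by
    have h := (exists_dual_vectors B).choose_spec.1 v c
    rw [placeCoord_apply]
    funext l'
    rcases eq_or_ne l' l with rfl | hl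
    · simpa using h
    · simp [hl, sigmaStarStar]
  Λ_e_ne v w l c hvw := by
    have h := (exists_dual_vectors B).choose_spec.2 v w c hvw
    rw [placeCoord_apply]
    funext l'
    rcases eq_or_ne l' l with rfl | hl
    · simpa using h
    · simp [hl, sigmaStarStar]
  P f v := conjPoly B f.1 v.embedding
  deg_le f v := (Finset.sup_mono (support_map_subset _ _)).trans f.2
  μ v := mult v
  μ_ne v := mult_coe_ne_zero
  re_proj_mul f v l c x := by
    rw [placeProj]
    split_ifs with hv
    -- At a real place the gradient is real, so the imaginary part of `c` does not affect the real
    -- part of the product.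
    · have h := conj_eval_wordDeriv B f.1 v.embedding x [l]
      rw [conjugate_embedding_eq_of_isReal hv, ← placeCoord_apply] at h
      have him := Complex.conj_eq_iff_im.1 h
      change (_ * eval (placeCoord B v x) (wordDeriv [l] (conjPoly B f.1 v.embedding))).re =
        (c * eval (placeCoord B v x) (wordDeriv [l] (conjPoly B f.1 v.embedding))).re
      simp only [Complex.mul_re, him, Complex.ofReal_re, mul_zero]
    · rfl

/-- The trace is real, so real parts may be taken in the sum over embeddings. Conjugate embeddings
then contribute equally, whence the coefficients `mult v`. -/
theorem phaseSystem_phase (f : BoundedPoly B n d) (x : Fin n → Fin k → ℝ) :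
    (phaseSystem B n d).phase f x = phase B f.1 x := by
  have hval : ∀ σ : K →+* ℂ, (sigmaStar B σ (fStar B f.1 x)).re =
      (eval (placeCoord B (mk σ) x) (conjPoly B f.1 (mk σ).embedding)).re := by
    intro σ
    rw [placeCoord_apply, conjPoly, eval_map_sigmaStar]
    change _ = (sigmaStar B _ (fStar B f.1 x)).re
    rcases mk_eq_iff.1 (mk_embedding (mk σ)) with h | h
    · rw [h]
    · conv_lhs => rw [← h, ← conj_sigmaStar, Complex.conj_re]
  have h := congrArg Complex.re (trStar_eq_sum B (fStar B f.1 x))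
  rw [Complex.ofReal_re, Complex.re_sum, Finset.sum_congr rfl fun σ _ => hval σ,
    sum_embeddings_eq_sum_places
      fun v => (eval (placeCoord B v x) (conjPoly B f.1 v.embedding)).re] at h
  rw [phase, h, PhaseSystem.phase]
  exact Finset.sum_congr rfl fun v _ => (nsmul_eq_mul _ _).symm

/-- A derivative of order `j ≥ 1` is at most `mass ^ j`, and the factor `1 / α!` only decreases it.
-/
theorem hPoint_le_mass (f : BoundedPoly B n d) (v : InfinitePlace K) (x : Fin n → Fin k → ℝ) :
    hPoint B f.1 v.embedding x ≤ ENNReal.ofReal ((phaseSystem B n d).mass f v x) := by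
  set Φ := phaseSystem B n d
  refine iSup₂_le fun α hα => ?_
  have hQ : eval (fun l => sigmaStarStar B v.embedding (x l))
      (partialDeriv α (conjPoly B f.1 v.embedding)) = Φ.Q f v (sortedWord α) x := by
    rw [partialDeriv_eq_wordDeriv, ← placeCoord_apply]
    rfl
  rw [hQ, ← length_sortedWord]
  rw [← length_sortedWord] at hα
  set w := sortedWord α
  have hm := Φ.mass_pos f v x
  have hb : ‖Φ.Q f v w x‖ ≤ Φ.mass f v x ^ w.length := by
    rcases hα.eq_or_lt with h1 | h2
    · obtain ⟨l, hl⟩ := List.length_eq_one_iff.1 h1.symm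
      rw [hl]
      simpa using Φ.norm_Q_singleton_le f v x l
    · exact (Φ.norm_Q_le f v x h2).trans
        (pow_le_pow_left₀ (Φ.scale_pos f v x).le (Φ.scale_le_mass f v x) _)
  have hfac : ‖(1 / ((∏ l, (α l).factorial : ℕ) : ℂ))‖ ≤ 1 := by
    rw [norm_div, norm_one, Complex.norm_natCast]
    refine div_le_one_of_le₀ ?_ (Nat.cast_nonneg _)
    exact_mod_cast Finset.prod_pos fun l _ => (α l).factorial_pos
  have hle : ‖(1 / ((∏ l, (α l).factorial : ℕ) : ℂ)) * Φ.Q f v w x‖ ≤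
      Φ.mass f v x ^ w.length := by
    rw [norm_mul]
    exact (mul_le_of_le_one_left (norm_nonneg _) hfac).trans hb
  rw [← ofReal_norm, ENNReal.ofReal_rpow_of_nonneg (norm_nonneg _) (by positivity)]
  refine ENNReal.ofReal_le_ofReal ?_
  refine (Real.rpow_le_rpow (norm_nonneg _) hle (by positivity)).trans_eq ?_
  rw [one_div, Real.pow_rpow_inv_natCast hm.le (by omega)]

/-- At a complex place the lines are complex. At a real place the parameter is real and a complex
root is replaced by its real part, which is no farther away. -/
theorem removable_phaseSystem (v : InfinitePlace K) :
    (phaseSystem B n d).Removable volume v (mult v) := by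
  rcases isReal_or_isComplex v with hv | hv
  · have h := (phaseSystem B n d).removable_of_coordinate volume (v := v) (F := ℝ)
      (κ := Complex.ofRealCLM.toLinearMap) (fun t => by
        change placeProj v (t : ℂ) = t
        rw [placeProj, if_pos hv, Complex.ofReal_re])
      (r := Complex.re) (fun t z => by
        change ‖t - z.re‖ ≤ ‖(t : ℂ) - z‖
        simpa using Complex.abs_re_le_norm ((t : ℂ) - z)) (by simp)
    rw [mult, if_pos hv]
    simpa using h
  · have hv' := not_isReal_iff_isComplex.2 hv
    have h := (phaseSystem B n d).removable_of_coordinate volume (v := v) (F := ℂ)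
      (κ := LinearMap.id) (fun t => by
        change placeProj v t = t
        rw [placeProj, if_neg hv'])
      (r := id) (fun t z => le_rfl) (by simp [Complex.finrank_real_complex])
    rw [mult, if_neg hv']
    simpa [Complex.finrank_real_complex] using h

/-- On the support of `ψ` the mass is at least the `H`-functional, so the sixth power of each gain
equals its cut-off there and the cut-offs can be removed in turn. -/
theorem exists_enorm_oscInt_le {ψ : (Fin n → Fin k → ℝ) → ℂ} (hψ : ContDiff ℝ ∞ ψ)
    (hψc : HasCompactSupport ψ) (A : Finset (InfinitePlace K)) : ∃ C : ℝ≥0,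
      ∀ (f : BoundedPoly B n d) (H : InfinitePlace K → ℝ), (∀ v ∈ A, 1 ≤ H v) →
        (∀ v ∈ A, ENNReal.ofReal (H v) ≤ hUnif B f.1 v.embedding ψ) →
        ‖oscInt B ψ f.1‖ₑ ≤ C * ∏ v ∈ A, ENNReal.ofReal ((H v ^ mult v)⁻¹) := by
  set Φ := phaseSystem B n d with hΦ
  obtain ⟨R, hR⟩ := hψc.isCompact.isBounded.subset_closedBall 0
  obtain ⟨C₁, -, h₁⟩ := Φ.exists_norm_integral_osc_le volume hψ hψc 6 A
  obtain ⟨C₂, h₂⟩ := Φ.exists_lintegral_prod_cut_le volume (m := mult)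
    (fun v => removable_phaseSystem B v) A R
  refine ⟨C₁.toNNReal * C₂, fun f H hH hHu => ?_⟩
  have hosc : oscInt B ψ f.1 = ∫ x, Φ.osc f x * ψ x := by
    simp only [oscInt, PhaseSystem.osc, hΦ, phaseSystem_phase]
  rw [hosc, ← ofReal_norm]
  refine (h₁ f).trans ?_
  rw [ENNReal.coe_mul, mul_assoc]
  refine mul_le_mul' le_rfl (le_trans ?_ (h₂ f H hH))
  refine le_trans ?_ (lintegral_mono_set hR)
  refine setLIntegral_mono' (isClosed_tsupport ψ).measurableSet fun x hx => ?_
  refine Finset.prod_le_prod' fun v hv => ?_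
  have hm : H v ≤ Φ.mass f v x := by
    rw [← ENNReal.ofReal_le_ofReal_iff (Φ.mass_pos f v x).le]
    exact ((hHu v hv).trans (iInf₂_le x hx)).trans (hPoint_le_mass B f v x)
  rw [PhaseSystem.cut, Set.indicator_of_mem (by simpa using hm)]

end System

end

end NumberFieldOscillatory

/-! ### The decay estimate for sets of embeddings. -/

theorem mainTheorem1 {K : Type*} [Field K] [NumberField K] {k : ℕ}
    (B : Module.Basis (Fin k) ℚ K) (n d : ℕ)
    (ψ : (Fin n → Fin k → ℝ) → ℂ) (hψ : ContDiff ℝ ∞ ψ) (hψc : HasCompactSupport ψ) :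
    ∃ C : ℝ≥0, 0 < C ∧
      ∀ f : MvPolynomial (Fin n) (NumberFieldOscillatory.realAlg B),
        f ≠ 0 → f.totalDegree ≤ d →
        ∀ S : Finset (K →+* ℂ),
          (∀ τ : K →+* ℂ, τ ∈ S ↔ NumberField.ComplexEmbedding.conjugate τ ∈ S) →
          ‖NumberFieldOscillatory.oscInt B ψ f‖ₑ ≤
            (C : ℝ≥0∞) * (NumberFieldOscillatory.hSet B f S ψ)⁻¹ := by
  classical
  choose C hC using fun A : Finset (NumberField.InfinitePlace K) =>
    NumberFieldOscillatory.exists_enorm_oscInt_le (d := d) B hψ hψc A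
  -- The set of places used below depends on `f` and `S`, so the constants of all finitely many sets
  -- are added; the `1` ensures positivity.
  refine ⟨1 + ∑ A, C A, by positivity, fun f _ hf S hS => ?_⟩
  rcases (tsupport ψ).eq_empty_or_nonempty with hempty | ⟨x₀, hx₀⟩
  · rw [tsupport_eq_empty_iff] at hempty
    simp [NumberFieldOscillatory.oscInt, hempty]
  rw [NumberFieldOscillatory.hSet_eq_prod_places B f S hS]
  set U : NumberField.InfinitePlace K → ℝ≥0∞ := fun v =>
    NumberFieldOscillatory.hUnif B f v.embedding ψ with hU
  -- A point of the support bounds the infimum by a finite mass.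
  have hfin : ∀ v, U v ≠ ⊤ := fun v => ne_top_of_le_ne_top ENNReal.ofReal_ne_top
    ((iInf₂_le x₀ hx₀).trans (NumberFieldOscillatory.hPoint_le_mass B ⟨f, hf⟩ v x₀))
  have hof : ∀ v, ENNReal.ofReal (U v).toReal = U v := fun v => ENNReal.ofReal_toReal (hfin v)
  -- Places with `U v < 1` are dropped: they can only decrease the product, so omitting them gives a
  -- stronger bound. This also covers a vanishing product.
  set A := (S.image NumberField.InfinitePlace.mk).filter fun v => 1 ≤ U v with hA
  have h1 : ∀ v ∈ A, 1 ≤ (U v).toReal := fun v hv => by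
    rw [← ENNReal.ofReal_le_ofReal_iff ENNReal.toReal_nonneg, hof, ENNReal.ofReal_one]
    exact (Finset.mem_filter.1 hv).2
  refine (hC A ⟨f, hf⟩ (fun v => (U v).toReal) h1 fun v _ => (hof v).le).trans ?_
  refine mul_le_mul' ?_ ?_
  · refine ENNReal.coe_le_coe.2 (le_add_left ?_)
    exact Finset.single_le_sum (f := C) (fun _ _ => zero_le) (Finset.mem_univ A)
  · have h2 : ∏ v ∈ A, ENNReal.ofReal (((U v).toReal ^ v.mult)⁻¹) =
        (∏ v ∈ A, U v ^ v.mult)⁻¹ := by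
      rw [← ENNReal.ofReal_prod_of_nonneg fun v _ => by positivity, Finset.prod_inv_distrib,
        ENNReal.ofReal_inv_of_pos (Finset.prod_pos fun v hv => pow_pos
          (zero_lt_one.trans_le (h1 v hv)) _),
        ENNReal.ofReal_prod_of_nonneg fun v _ => by positivity]
      congr 1
      refine Finset.prod_congr rfl fun v _ => ?_
      rw [ENNReal.ofReal_pow ENNReal.toReal_nonneg, hof]
    rw [h2, ENNReal.inv_le_inv, ← Finset.prod_filter_mul_prod_filter_not
      (S.image NumberField.InfinitePlace.mk) fun v => 1 ≤ U v]
    refine mul_le_of_le_one_right' (Finset.prod_le_one' fun v hv => pow_le_one' ?_ _)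
    exact (not_le.1 (Finset.mem_filter.1 hv).2).le
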